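/- **Circuits.** Polarisation-preserving circuits are the morphisms of the PRO (strict monoidal category with objects the natural numbers, composition $\circ$, tensor $\oplus$ = vertical juxtaposition; circuits are thus taken up to deformation) freely generated by phase shifters $P(\varphi):1\to1$ and beam splitters $B(\theta):2\to2$, $\varphi,\theta\in\mathbb R$. All circuits go $n\to n$; wires are numbered $0,\dots,n-1$ from top to bottom. Write $P_k(\varphi)$ for a phase shifter on wire $k$, $B_k(\theta)$ for a beam splitter on wires $k,k+1$, and $A;A'$ for "first $A$, then $A'$". The semantics $[\![D]\!]$ is the unitary $n\times n$ matrix given by $[\![P(\varphi)]\!]=(e^{i\varphi})$, $[\![B(\theta)]\!]=\begin{pmatrix}\cos\theta&i\sin\theta\\ i\sin\theta&\cos\theta\end{pmatrix}$, with $\circ$ the matrix product and $\oplus$ the direct sum. **The rewrite system PPRS** has the following rules, applicable to any sub-circuit: 1. $P(\psi)\to P(\psi \bmod 2\pi)$ and $B(\psi)\to B(\psi\bmod 2\pi)$, for $\psi\notin[0,2\pi)$; 2. $P(\varphi_1);P(\varphi_2)\to P(\varphi_1+\varphi_2)$, for $\varphi_1,\varphi_2\in(0,2\pi)$; 3. $P(0)\to$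 the identity wire, and $B(0)\to$ two identity wires; 4. $P_1(\varphi);B_0(\theta)\to P_0(-\varphi);B_0(\theta);P_0(\varphi);P_1(\varphi)$, for $\varphi\in(0,2\pi)$, $\theta\in(0,\pi)$; 5. $P_0(\varphi);B_0(\tfrac\pi2)\to B_0(\tfrac\pi2);P_1(\varphi)$, for $\varphi\in(0,2\pi)$; 6. $P_0(\varphi);B_0(\theta)\to P_0(\varphi-\pi);B_0(\pi-\theta);P_1(\pi)$, for $\varphi\in[\pi,2\pi)$, $\theta\in(0,\pi)\setminus\{\tfrac\pi2\}$; 7. $B_0(\theta)\to B_0(\theta-\pi);P_0(\pi);P_1(\pi)$, for $\theta\in[\pi,2\pi)$; 8. $B_0(\theta_1);P_1^{?}(\varphi_1);P_0^{?}(\varphi_2);B_1(\theta_2);B_0(\theta_3)\to P_1(\beta_1);B_1(\alpha_1);P_0(\beta_2);B_0(\alpha_2);P_1(\beta_3);B_1(\alpha_3);P_0(\beta_4);P_1(\beta_5);P_2(\beta_6)$ on three wires, for arbitrary real angles on the left, where the right-hand side has the same semantics as the left-hand side and $\alpha_1,\alpha_2,\alpha_3,\beta_1,\beta_2,\beta_3\in[0,\pi)$,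 $\beta_4,\beta_5,\beta_6\in[0,2\pi)$, $\alpha_i\in\{0,\frac\pi2\}\Rightarrow\beta_i=0$ for $i\in\{1,2,3\}$, $\alpha_2=0\Rightarrow\alpha_1=0$; 9. $B_0(\theta_1);P_0^{?}(\varphi);B_0(\theta_2)\to P_0(\beta_1);B_0(\alpha_1);P_0(\beta_2);P_1(\beta_3)$ on two wires, for arbitrary real angles on the left, where the right-hand side has the same semantics as the left-hand side and $\alpha_1,\beta_1\in[0,\pi)$, $\beta_2,\beta_3\in[0,2\pi)$, $\alpha_1\in\{0,\frac\pi2\}\Rightarrow\beta_1=0$. Here $P^{?}$ means that the phase shifter is either present or replaced by a plain wire. **Triangular normal forms.** A circuit on $n$ wires is a *PPRS triangular normal form* if it is $D_0;D_1;\dots;D_{n-1}$ with $$D_i=P^*_{n-2}(\beta_{i,n-2-i});B^*_{n-2}(\alpha_{i,n-2-i});\ \dots\ ;P^*_{i+1}(\beta_{i,1});B^*_{i+1}(\alpha_{i,1});P^*_{i}(\beta_{i,0});B^*_{i}(\alpha_{i,0});P^*_i(\gamma_i),$$ where the star means that a generator of angle $0$ is replaced by the identity, and the angles satisfy $\alpha_{i,j},\beta_{i,j}\in[0,\pi)$;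 $\gamma_i\in[0,2\pi)$; $\alpha_{i,j}=0\Rightarrow\forall j'>j,\ \alpha_{i,j'}=0$; $\alpha_{i,j}\in\{0,\frac\pi2\}\Rightarrow\beta_{i,j}=0$. **Theorem.** Every polarisation-preserving circuit $D:n\to n$ converges under PPRS to a unique PPRS triangular normal form. That is: there is no infinite sequence of PPRS rewriting steps starting from $D$; and there is a PPRS triangular normal form $N$, to which no rule applies, such that $D$ rewrites to $N$, every circuit reachable from $D$ rewrites to $N$, and every circuit reachable from $D$ which is a PPRS triangular normal form or to which no rule applies equals $N$. -/

import Mathlib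

noncomputable section

namespace LOv

/-- Terms for polarisation-preserving circuits: diagrams with `n` input and `n` output wires, built
from phase shifters and beam splitters by sequential composition (`comp d₂ d₁` is `d₂ ∘ d₁`, i.e.
`d₁` first) and parallel composition (`tensor d₁ d₂` is `d₁ ⊕ d₂`, with `d₁` on the upper wires).
Every generator has as many outputs as inputs, so there are no diagrams `n → m` with `n ≠ m`. -/
inductive PPTerm : ℕ → Type
  | empty : PPTerm 0
  | wire : PPTerm 1
  | phase (φ : ℝ) : PPTerm 1
  | bs (θ : ℝ) : PPTerm 2
  | comp {n : ℕ} (d₂ d₁ : PPTerm n) : PPTerm n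
  | tensor {n m : ℕ} (d₁ : PPTerm n) (d₂ : PPTerm m) : PPTerm (n + m)

namespace PPTerm

/-- `n` parallel identity wires. -/
def idn : (n : ℕ) → PPTerm n
  | 0 => empty
  | n + 1 => tensor (idn n) wire

/-- Transport along an equality of numbers of wires. -/
def castWires {n m : ℕ} (h : n = m) (d : PPTerm n) : PPTerm m := h ▸ d

end PPTerm

open PPTerm in
/-- Equality of diagrams up to deformation: the smallest congruence containing the axioms of a PRO
(strict monoidal category whose objects are the natural numbers). It relates terms whose numbers of
wires are equal but not syntactically so, such as `(a + b) + c` and `a + (b + c)`. -/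
inductive PROEq : ∀ {n m : ℕ}, PPTerm n → PPTerm m → Prop
  | refl {n : ℕ} (a : PPTerm n) : PROEq a a
  | symm {n m : ℕ} {a : PPTerm n} {b : PPTerm m} : PROEq a b → PROEq b a
  | trans {n m k : ℕ} {a : PPTerm n} {b : PPTerm m} {c : PPTerm k} :
      PROEq a b → PROEq b c → PROEq a c
  | comp_congr {n m : ℕ} {a b : PPTerm n} {a' b' : PPTerm m} :
      PROEq a a' → PROEq b b' → PROEq (comp a b) (comp a' b')
  | tensor_congr {n m n' m' : ℕ} {a : PPTerm n} {b : PPTerm m} {a' : PPTerm n'} {b' : PPTerm m'} :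
      PROEq a a' → PROEq b b' → PROEq (tensor a b) (tensor a' b')
  | comp_assoc {n : ℕ} (a b c : PPTerm n) : PROEq (comp (comp a b) c) (comp a (comp b c))
  | id_comp {n : ℕ} (a : PPTerm n) : PROEq (comp (idn n) a) a
  | comp_id {n : ℕ} (a : PPTerm n) : PROEq (comp a (idn n)) a
  | tensor_assoc {n m k : ℕ} (a : PPTerm n) (b : PPTerm m) (c : PPTerm k) :
      PROEq (tensor (tensor a b) c) (tensor a (tensor b c))
  | empty_tensor {n : ℕ} (a : PPTerm n) : PROEq (tensor empty a) a
  | tensor_empty {n : ℕ} (a : PPTerm n) : PROEq (tensor a empty) a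
  | interchange {n m : ℕ} (a c : PPTerm n) (b d : PPTerm m) :
      PROEq (comp (tensor a b) (tensor c d)) (tensor (comp a c) (comp b d))

/-- Equality up to deformation of diagrams on `n` wires. -/
def proSetoid (n : ℕ) : Setoid (PPTerm n) where
  r a b := PROEq a b
  iseqv := ⟨PROEq.refl, PROEq.symm, PROEq.trans⟩

/-- Polarisation-preserving circuits `n → n`: the morphisms of the PRO generated by phase shifters
and beam splitters. -/
def PPCircuit (n : ℕ) : Type := Quotient (proSetoid n)

/-- The circuit represented by a term. -/
def PPTerm.toCircuit {n : ℕ} (d : PPTerm n) : PPCircuit n := Quotient.mk (proSetoid n) d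

namespace PPTerm

/-- Single-photon semantics in a fixed polarisation, as an `n × n` complex matrix: a phase shifter is
`e^{iφ}`, a beam splitter is `(cos θ, i sin θ; i sin θ, cos θ)`, `∘` is the matrix product and `⊕` the
direct sum. -/
def sem : {n : ℕ} → PPTerm n → Matrix (Fin n) (Fin n) ℂ
  | _, empty => 1
  | _, wire => 1
  | _, phase φ => !![Complex.exp (Complex.I * φ)]
  | _, bs θ => !![(Real.cos θ : ℂ), Complex.I * (Real.sin θ : ℂ);
                  Complex.I * (Real.sin θ : ℂ), (Real.cos θ : ℂ)]
  | _, comp d₂ d₁ => sem d₂ * sem d₁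
  | _, tensor d₁ d₂ =>
      Matrix.reindex finSumFinEquiv finSumFinEquiv (Matrix.fromBlocks (sem d₁) 0 0 (sem d₂))

/-- An optional phase shifter: either a phase shifter or a plain wire. -/
def optPhase : Option ℝ → PPTerm 1
  | none => wire
  | some φ => phase φ

/-- Beam splitter, optional phase shifter on the top wire, beam splitter. -/
def twoBS (θ₁ θ₂ : ℝ) (φ : Option ℝ) : PPTerm 2 :=
  comp (bs θ₂) (comp (tensor (optPhase φ) wire) (bs θ₁))

/-- The two-mode triangle: phase `β₁` on the top wire, beam splitter `α₁`, then phases `β₂` and `β₃`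
on the top and on the bottom wire. -/
def triangle2 (α₁ β₁ β₂ β₃ : ℝ) : PPTerm 2 :=
  comp (tensor (phase β₂) (phase β₃)) (comp (bs α₁) (tensor (phase β₁) wire))

/-- Three beam splitters pointing downwards: beam splitter `θ₁` on wires 0 and 1, optional phases `φ₂`
on wire 0 and `φ₁` on wire 1, beam splitter `θ₂` on wires 1 and 2, beam splitter `θ₃` on wires 0
and 1. -/
def threeBS (θ₁ θ₂ θ₃ : ℝ) (φ₁ φ₂ : Option ℝ) : PPTerm 3 :=
  comp (tensor (bs θ₃) wire)
    (comp (tensor wire (bs θ₂))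
      (comp (tensor (tensor (optPhase φ₂) (optPhase φ₁)) wire)
        (tensor (bs θ₁) wire)))

/-- The three-mode triangle, pointing upwards: phase `β₁` on wire 1 and beam splitter `α₁` on wires 1
and 2, phase `β₂` on wire 0 and beam splitter `α₂` on wires 0 and 1, phase `β₃` on wire 1 and beam
splitter `α₃` on wires 1 and 2, then phases `β₄`, `β₅`, `β₆` on wires 0, 1, 2. -/
def triangle3 (α₁ α₂ α₃ β₁ β₂ β₃ β₄ β₅ β₆ : ℝ) : PPTerm 3 :=
  comp (tensor (tensor (phase β₄) (phase β₅)) (phase β₆))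
    (comp (tensor wire (comp (bs α₃) (tensor (phase β₃) wire)))
      (comp (tensor (comp (bs α₂) (tensor (phase β₂) wire)) wire)
        (tensor wire (comp (bs α₁) (tensor (phase β₁) wire)))))

end PPTerm

/-- The angle constraints that make the two-mode triangle of a unitary unique. -/
def Angles2 (α₁ β₁ β₂ β₃ : ℝ) : Prop :=
  α₁ ∈ Set.Ico 0 Real.pi ∧ β₁ ∈ Set.Ico 0 Real.pi ∧
  β₂ ∈ Set.Ico 0 (2 * Real.pi) ∧ β₃ ∈ Set.Ico 0 (2 * Real.pi) ∧
  (α₁ = 0 ∨ α₁ = Real.pi / 2 → β₁ = 0)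

/-- The angle constraints that make the three-mode triangle of a unitary unique. -/
def Angles3 (α₁ α₂ α₃ β₁ β₂ β₃ β₄ β₅ β₆ : ℝ) : Prop :=
  α₁ ∈ Set.Ico 0 Real.pi ∧ α₂ ∈ Set.Ico 0 Real.pi ∧ α₃ ∈ Set.Ico 0 Real.pi ∧
  β₁ ∈ Set.Ico 0 Real.pi ∧ β₂ ∈ Set.Ico 0 Real.pi ∧ β₃ ∈ Set.Ico 0 Real.pi ∧
  β₄ ∈ Set.Ico 0 (2 * Real.pi) ∧ β₅ ∈ Set.Ico 0 (2 * Real.pi) ∧ β₆ ∈ Set.Ico 0 (2 * Real.pi) ∧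
  (α₁ = 0 ∨ α₁ = Real.pi / 2 → β₁ = 0) ∧
  (α₂ = 0 ∨ α₂ = Real.pi / 2 → β₂ = 0) ∧
  (α₃ = 0 ∨ α₃ = Real.pi / 2 → β₃ = 0) ∧
  (α₂ = 0 → α₁ = 0)

/-- The representative of `x` modulo `2π` in `[0, 2π)`. -/
def modTwoPi (x : ℝ) : ℝ := toIcoMod Real.two_pi_pos 0 x

open PPTerm in
/-- The rewriting rules of PPRS (left-hand side, right-hand side). -/
inductive Rule : ∀ {n : ℕ}, PPTerm n → PPTerm n → Prop
  | phase_mod (ψ : ℝ) (hψ : ψ ∉ Set.Ico 0 (2 * Real.pi)) :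
      Rule (phase ψ) (phase (modTwoPi ψ))
  | bs_mod (ψ : ℝ) (hψ : ψ ∉ Set.Ico 0 (2 * Real.pi)) :
      Rule (bs ψ) (bs (modTwoPi ψ))
  | phase_fusion (φ₁ φ₂ : ℝ) (h₁ : φ₁ ∈ Set.Ioo 0 (2 * Real.pi))
      (h₂ : φ₂ ∈ Set.Ioo 0 (2 * Real.pi)) :
      Rule (comp (phase φ₂) (phase φ₁)) (phase (φ₁ + φ₂))
  | phase_zero : Rule (phase 0) wire
  | bs_zero : Rule (bs 0) (tensor wire wire)
  | bottom_phase (φ θ : ℝ) (hφ : φ ∈ Set.Ioo 0 (2 * Real.pi)) (hθ : θ ∈ Set.Ioo 0 Real.pi) :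
      Rule (comp (bs θ) (tensor wire (phase φ)))
        (comp (tensor (phase φ) (phase φ)) (comp (bs θ) (tensor (phase (-φ)) wire)))
  | top_phase_half_pi (φ : ℝ) (hφ : φ ∈ Set.Ioo 0 (2 * Real.pi)) :
      Rule (comp (bs (Real.pi / 2)) (tensor (phase φ) wire))
        (comp (tensor wire (phase φ)) (bs (Real.pi / 2)))
  | top_phase_sub_pi (φ₀ θ₀ : ℝ) (hφ : φ₀ ∈ Set.Ico Real.pi (2 * Real.pi))
      (hθ : θ₀ ∈ Set.Ioo 0 Real.pi) (hθ' : θ₀ ≠ Real.pi / 2) :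
      Rule (comp (bs θ₀) (tensor (phase φ₀) wire))
        (comp (tensor wire (phase Real.pi))
          (comp (bs (Real.pi - θ₀)) (tensor (phase (φ₀ - Real.pi)) wire)))
  | bs_sub_pi (θ₄ : ℝ) (hθ : θ₄ ∈ Set.Ico Real.pi (2 * Real.pi)) :
      Rule (bs θ₄) (comp (tensor (phase Real.pi) (phase Real.pi)) (bs (θ₄ - Real.pi)))
  | euler3 (θ₁ θ₂ θ₃ : ℝ) (φ₁ φ₂ : Option ℝ) (α₁ α₂ α₃ β₁ β₂ β₃ β₄ β₅ β₆ : ℝ)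
      (hangles : Angles3 α₁ α₂ α₃ β₁ β₂ β₃ β₄ β₅ β₆)
      (hsem : (triangle3 α₁ α₂ α₃ β₁ β₂ β₃ β₄ β₅ β₆).sem = (threeBS θ₁ θ₂ θ₃ φ₁ φ₂).sem) :
      Rule (threeBS θ₁ θ₂ θ₃ φ₁ φ₂) (triangle3 α₁ α₂ α₃ β₁ β₂ β₃ β₄ β₅ β₆)
  | euler2 (θ₁ θ₂ : ℝ) (φ : Option ℝ) (α₁ β₁ β₂ β₃ : ℝ)
      (hangles : Angles2 α₁ β₁ β₂ β₃)
      (hsem : (triangle2 α₁ β₁ β₂ β₃).sem = (twoBS θ₁ θ₂ φ).sem) :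
      Rule (twoBS θ₁ θ₂ φ) (triangle2 α₁ β₁ β₂ β₃)

open PPTerm in
/-- Application of one rule to a subterm. -/
inductive TermStep : ∀ {n : ℕ}, PPTerm n → PPTerm n → Prop
  | rule {n : ℕ} {a b : PPTerm n} : Rule a b → TermStep a b
  | comp_left {n : ℕ} {a a' : PPTerm n} (b : PPTerm n) :
      TermStep a a' → TermStep (comp a b) (comp a' b)
  | comp_right {n : ℕ} (a : PPTerm n) {b b' : PPTerm n} :
      TermStep b b' → TermStep (comp a b) (comp a b')
  | tensor_left {n m : ℕ} {a a' : PPTerm n} (b : PPTerm m) :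
      TermStep a a' → TermStep (tensor a b) (tensor a' b)
  | tensor_right {n m : ℕ} (a : PPTerm n) {b b' : PPTerm m} :
      TermStep b b' → TermStep (tensor a b) (tensor a b')

/-- One rewriting step of PPRS between circuits (diagrams up to deformation). -/
def Step {n : ℕ} (D D' : PPCircuit n) : Prop :=
  ∃ d d' : PPTerm n, d.toCircuit = D ∧ d'.toCircuit = D' ∧ TermStep d d'

/-- Finitely many (possibly zero) rewriting steps. -/
def Rewrites {n : ℕ} (D D' : PPCircuit n) : Prop := Relation.ReflTransGen Step D D'

/-- No rule applies. -/
def IsIrreducible {n : ℕ} (D : PPCircuit n) : Prop := ∀ D' : PPCircuit n, ¬ Step D D'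

/-- There is no infinite sequence of rewriting steps starting from `D`. -/
def StronglyNormalising {n : ℕ} (D : PPCircuit n) : Prop :=
  ¬ ∃ s : ℕ → PPCircuit n, s 0 = D ∧ ∀ k, Step (s k) (s (k + 1))

namespace PPTerm

/-- The generator `g` placed on the wires `k, …, k + a - 1` of `n` wires (only used when it fits). -/
def place (n k : ℕ) {a : ℕ} (g : PPTerm a) : PPTerm n :=
  if h : k + a ≤ n then castWires (by omega) (tensor (tensor (idn k) g) (idn (n - (k + a))))
  else idn n

/-- Starred phase shifter on wire `k`: the identity if the angle is `0`. -/
def starPhase (n k : ℕ) (φ : ℝ) : PPTerm n := if φ = 0 then idn n else place n k (phase φ)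

/-- Starred beam splitter on wires `k` and `k + 1`: the identity if the angle is `0`. -/
def starBS (n k : ℕ) (θ : ℝ) : PPTerm n := if θ = 0 then idn n else place n k (bs θ)

/-- Sequential composition of a list of diagrams, the head of the list coming first (leftmost). -/
def seqAll (n : ℕ) : List (PPTerm n) → PPTerm n
  | [] => idn n
  | d :: l => comp (seqAll n l) d

/-- The `i`-th antidiagonal of the triangle. From left to right: for `j = n - 2 - i, …, 1, 0`, the
phase `β i j` on wire `i + j` followed by the beam splitter `α i j` on wires `i + j` and `i + j + 1`;
at the end the phase `γ i` on wire `i`. -/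
def antidiagonal (n : ℕ) (α β : ℕ → ℕ → ℝ) (γ : ℕ → ℝ) (i : ℕ) : PPTerm n :=
  seqAll n
    (((List.range (n - 1 - i)).reverse.map fun j =>
        comp (starBS n (i + j) (α i j)) (starPhase n (i + j) (β i j)))
      ++ [starPhase n i (γ i)])

/-- The triangle: the antidiagonals `0, 1, …, n - 1`, from left to right. -/
def triangle (n : ℕ) (α β : ℕ → ℕ → ℝ) (γ : ℕ → ℝ) : PPTerm n :=
  seqAll n ((List.range n).map (antidiagonal n α β γ))

end PPTerm

/-- The conditions on the angles of a triangular normal form on `n` wires. Only the `α i j`, `β i j`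
with `i + j + 1 < n` and the `γ i` with `i < n` occur in the circuit. -/
def TriangleAngles (n : ℕ) (α β : ℕ → ℕ → ℝ) (γ : ℕ → ℝ) : Prop :=
  (∀ i j, i + j + 1 < n →
    α i j ∈ Set.Ico 0 Real.pi ∧ β i j ∈ Set.Ico 0 Real.pi ∧
    (α i j = 0 → ∀ j', j < j' → i + j' + 1 < n → α i j' = 0) ∧
    (α i j = 0 ∨ α i j = Real.pi / 2 → β i j = 0)) ∧
  (∀ i, i < n → γ i ∈ Set.Ico 0 (2 * Real.pi))

/-- PPRS triangular normal forms. -/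
def IsTriangularNF {n : ℕ} (N : PPCircuit n) : Prop :=
  ∃ (α β : ℕ → ℕ → ℝ) (γ : ℕ → ℝ),
    TriangleAngles n α β γ ∧ N = (PPTerm.triangle n α β γ).toCircuit

end LOv

end

noncomputable section

namespace LOv

open PPTerm

/-! The argument uses no critical pairs. Rewriting preserves the matrix of a circuit, so confluence
follows once every irreducible circuit is known to be determined by its matrix. Four facts carry the
proof.

Termination (`Step.measure_lt`): a lexicographic measure, invariant under deformation, decreases at
each step. It consists of the total height of the beam splitters, the total class of their angles,
and a weighted cost of the phase shifters. The cost of a phase depends on the beam splitters that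
follow it, so that pushing a phase through a beam splitter pays for the phases this creates.

Uniqueness (`mat_injective_of_isTriangularNF`): the first row of the matrix of a triangle comes from
its first antidiagonal and the phase ending it. That row is a unit vector in a kind of spherical
coordinates, and the angle constraints make the coordinates unique. Dividing by this antidiagonal
leaves a matrix 1 ⊕ V, and induction applies to V.

Existence (`exists_isTriangularNF`): the same elimination produces a triangle for every unitary
matrix. For 2 and 3 wires it supplies right-hand sides for `euler2` and `euler3`, which therefore
apply to every instance of their left-hand sides.

Irreducible circuits are triangular (`isTriangularNF_of_isIrreducible`): appending a generator to a
triangle gives either a triangle or a reducible circuit. The only delicate case is a beam splitter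
on the two top wires, where one of the Euler rules applies unless the first antidiagonal is trivial.

All irreducible or triangular circuits reachable from a given circuit then have the same matrix and
are triangular, hence coincide. That triangles are irreducible never has to be checked rule by rule.
-/

/-! ### Circuits as monoids, and their extension by further wires. -/

theorem PROEq.wires_eq {n m : ℕ} {a : PPTerm n} {b : PPTerm m} (h : PROEq a b) : n = m := by
  induction h <;> omega

theorem PPTerm.castWires_proEq {n m : ℕ} (h : n = m) (d : PPTerm n) : PROEq (castWires h d) d := by
  subst h; exact .refl _

theorem PPTerm.idn_congr {n m : ℕ} (h : n = m) : PROEq (idn n) (idn m) := by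
  subst h; exact .refl _

theorem PPTerm.idn_one : PROEq (idn 1) wire := .empty_tensor _

theorem PPTerm.idn_tensor_idn (a : ℕ) : ∀ b, PROEq (tensor (idn a) (idn b)) (idn (a + b))
  | 0 => .tensor_empty _
  | b + 1 => .trans (.symm (.tensor_assoc _ _ _)) (.tensor_congr (idn_tensor_idn a b) (.refl _))

theorem PPTerm.wire_tensor_idn (n : ℕ) : PROEq (tensor wire (idn n)) (idn (n + 1)) :=
  .trans (.tensor_congr (.symm idn_one) (.refl _))
    (.trans (idn_tensor_idn 1 n) (idn_congr (Nat.add_comm 1 n)))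

theorem PPTerm.wire_comp_wire : PROEq (comp wire wire) wire :=
  .trans (.comp_congr (.symm idn_one) (.refl _)) (.id_comp _)

theorem PPTerm.toCircuit_eq {n : ℕ} {a b : PPTerm n} : a.toCircuit = b.toCircuit ↔ PROEq a b :=
  ⟨fun h => Quotient.exact h, fun h => Quotient.sound h⟩

theorem PPCircuit.exists_term {n : ℕ} (D : PPCircuit n) : ∃ d : PPTerm n, d.toCircuit = D :=
  Quotient.exists_rep D

namespace PPCircuit

/-- The product is `comp`, so in `X * Y` the factor `Y` acts first: products read from right to left
in time. -/
instance {n : ℕ} : Monoid (PPCircuit n) where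
  mul := Quotient.map₂ comp fun _ _ h _ _ h' => PROEq.comp_congr h h'
  one := (idn n).toCircuit
  mul_assoc := by
    rintro ⟨a⟩ ⟨b⟩ ⟨c⟩
    exact Quotient.sound (PROEq.comp_assoc a b c)
  one_mul := by
    rintro ⟨a⟩
    exact Quotient.sound (PROEq.id_comp a)
  mul_one := by
    rintro ⟨a⟩
    exact Quotient.sound (PROEq.comp_id a)

theorem toCircuit_comp {n : ℕ} (a b : PPTerm n) :
    (comp a b).toCircuit = a.toCircuit * b.toCircuit := rfl

theorem toCircuit_idn (n : ℕ) : (idn n).toCircuit = 1 := rfl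

theorem toCircuit_wire : wire.toCircuit = 1 := toCircuit_eq.2 (.symm idn_one)

end PPCircuit

open PPCircuit

/-- A term with one more wire on top. -/
def PPTerm.shift {n : ℕ} (d : PPTerm n) : PPTerm (n + 1) :=
  castWires (Nat.add_comm 1 n) (tensor wire d)

/-- A term with `n` more wires at the bottom. -/
def PPTerm.top (n : ℕ) {a : ℕ} (d : PPTerm a) : PPTerm (n + a) :=
  castWires (Nat.add_comm a n) (tensor d (idn n))

theorem PPTerm.shift_proEq {n : ℕ} (d : PPTerm n) : PROEq d.shift (tensor wire d) :=
  castWires_proEq _ _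

theorem PPTerm.top_proEq (n : ℕ) {a : ℕ} (d : PPTerm a) : PROEq (d.top n) (tensor d (idn n)) :=
  castWires_proEq _ _

namespace PPCircuit

/-- One more wire on top of a circuit. -/
def shift {n : ℕ} : PPCircuit n →* PPCircuit (n + 1) where
  toFun := Quotient.map PPTerm.shift fun a b h =>
    .trans (shift_proEq a) (.trans (.tensor_congr (.refl _) h) (.symm (shift_proEq b)))
  map_one' := Quotient.sound (.trans (shift_proEq _) (wire_tensor_idn n))
  map_mul' := by
    rintro ⟨a⟩ ⟨b⟩
    exact Quotient.sound (.trans (shift_proEq _) (.trans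
      (.tensor_congr (.symm wire_comp_wire) (.refl _)) (.trans (.symm (.interchange _ _ _ _))
        (.comp_congr (.symm (shift_proEq _)) (.symm (shift_proEq _))))))

/-- `n` more wires at the bottom of a circuit. -/
def top (n : ℕ) {a : ℕ} : PPCircuit a →* PPCircuit (n + a) where
  toFun := Quotient.map (PPTerm.top n) fun x y h =>
    .trans (top_proEq n x) (.trans (.tensor_congr h (.refl _)) (.symm (top_proEq n y)))
  map_one' := Quotient.sound (.trans (top_proEq n _) (.trans (idn_tensor_idn a n)
    (idn_congr (Nat.add_comm a n))))
  map_mul' := by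
    rintro ⟨x⟩ ⟨y⟩
    exact Quotient.sound (.trans (top_proEq n _) (.trans
      (.tensor_congr (.refl _) (.symm (.id_comp _))) (.trans (.symm (.interchange _ _ _ _))
        (.comp_congr (.symm (top_proEq n _)) (.symm (top_proEq n _))))))

theorem shift_toCircuit {n : ℕ} (d : PPTerm n) : shift d.toCircuit = d.shift.toCircuit := rfl

theorem top_toCircuit (n : ℕ) {a : ℕ} (d : PPTerm a) :
    top n d.toCircuit = (d.top n).toCircuit := rfl

/-- The phase shifter as a circuit. -/
def P (φ : ℝ) : PPCircuit 1 := (phase φ).toCircuit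

/-- The beam splitter as a circuit. -/
def B (θ : ℝ) : PPCircuit 2 := (bs θ).toCircuit

theorem comp_tensor_idn_idn_tensor {a n : ℕ} (x : PPTerm a) (y : PPTerm n) :
    PROEq (comp (tensor x (idn n)) (tensor (idn a) y)) (tensor x y) :=
  .trans (.interchange _ _ _ _) (.tensor_congr (.comp_id _) (.id_comp _))

theorem comp_idn_tensor_tensor_idn {a n : ℕ} (x : PPTerm a) (y : PPTerm n) :
    PROEq (comp (tensor (idn a) y) (tensor x (idn n))) (tensor x y) :=
  .trans (.interchange _ _ _ _) (.tensor_congr (.id_comp _) (.comp_id _))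

theorem shift_shift_proEq {n : ℕ} (y : PPTerm n) : PROEq y.shift.shift (tensor (idn 2) y) :=
  .trans (shift_proEq _) (.trans (.tensor_congr (.refl _) (shift_proEq _))
    (.trans (.symm (.tensor_assoc _ _ _)) (.tensor_congr (.tensor_congr (.symm idn_one) (.refl _))
      (.refl _))))

theorem shift_proEq' {n : ℕ} (y : PPTerm n) : PROEq y.shift (tensor (idn 1) y) :=
  .trans (shift_proEq _) (.tensor_congr (.symm idn_one) (.refl _))

/-- Both products deform to `tensor x y`, by interchange: circuits on disjoint sets of wires
commute. -/
theorem comm_of_proEq {N a n : ℕ} {e f : PPTerm N} {x : PPTerm a} {y : PPTerm n}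
    (he : PROEq e (tensor x (idn n))) (hf : PROEq f (tensor (idn a) y)) :
    PROEq (comp e f) (comp f e) :=
  .trans (.comp_congr he hf) (.trans (comp_tensor_idn_idn_tensor x y)
    (.trans (.symm (comp_idn_tensor_tensor_idn x y)) (.symm (.comp_congr hf he))))

theorem top_mul_shift {n : ℕ} (x : PPCircuit 1) (y : PPCircuit n) :
    top n x * shift y = shift y * top n x := by
  induction x using Quotient.ind
  induction y using Quotient.ind
  exact Quotient.sound (comm_of_proEq (top_proEq n _) (shift_proEq' _))

theorem top_mul_shift_shift {n : ℕ} (x : PPCircuit 2) (y : PPCircuit n) :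
    top n x * shift (shift y) = shift (shift y) * top n x := by
  induction x using Quotient.ind
  induction y using Quotient.ind
  exact Quotient.sound (comm_of_proEq (top_proEq n _) (shift_shift_proEq _))

theorem shift_top (n : ℕ) {a : ℕ} (x : PPCircuit a) : shift (top n x) = top n (shift x) := by
  induction x using Quotient.ind
  exact Quotient.sound (.trans (shift_proEq _) (.trans (.tensor_congr (.refl _) (top_proEq n _))
    (.trans (.symm (.tensor_assoc _ _ _)) (.trans (.tensor_congr (.symm (shift_proEq _)) (.refl _))
      (.symm (top_proEq n _))))))

theorem top_top_proEq (n m : ℕ) {a : ℕ} (x : PPTerm a) :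
    PROEq ((x.top m).top n) (x.top (n + m)) :=
  .trans (top_proEq _ _) (.trans (.tensor_congr (top_proEq _ _) (.refl _))
    (.trans (.tensor_assoc _ _ _) (.trans (.tensor_congr (.refl _) (.trans (idn_tensor_idn _ _)
      (idn_congr (Nat.add_comm _ _)))) (.symm (top_proEq _ _)))))

/-- The two sides have definitionally equal types because `top` puts the added wires first in the
sum; this avoids casts between numbers of wires. -/
theorem top_top_one_phase (n : ℕ) (x : PPCircuit 1) :
    (top n (top 1 x : PPCircuit 2) : PPCircuit (n + 2)) =
      (top (n + 1) x : PPCircuit (n + 1 + 1)) := by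
  induction x using Quotient.ind
  exact Quotient.sound (top_top_proEq n 1 _)

theorem top_top_two_phase (n : ℕ) (x : PPCircuit 1) :
    (top n (top 2 x : PPCircuit 3) : PPCircuit (n + 3)) =
      (top (n + 2) x : PPCircuit (n + 2 + 1)) := by
  induction x using Quotient.ind
  exact Quotient.sound (top_top_proEq n 2 _)

theorem top_top_one_bs (n : ℕ) (x : PPCircuit 2) :
    (top n (top 1 x : PPCircuit 3) : PPCircuit (n + 3)) =
      (top (n + 1) x : PPCircuit (n + 1 + 2)) := by
  induction x using Quotient.ind
  exact Quotient.sound (top_top_proEq n 1 _)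

theorem tensor_eq {n : ℕ} (x : PPTerm 1) (y : PPTerm n) {e : PPTerm (n + 1)}
    (he : PROEq e (tensor x y)) :
    e.toCircuit = top n x.toCircuit * shift y.toCircuit :=
  Quotient.sound (.trans he (.trans (.symm (comp_tensor_idn_idn_tensor x y))
    (.comp_congr (.symm (top_proEq _ _)) (.symm (shift_proEq' _)))))

theorem toCircuit_tensor_one_one (x y : PPTerm 1) :
    (tensor x y).toCircuit = top 1 x.toCircuit * shift y.toCircuit :=
  tensor_eq x y (.refl _)

theorem toCircuit_tensor_one_two (x : PPTerm 1) (y : PPTerm 2) :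
    (tensor x y : PPTerm 3).toCircuit = top 2 x.toCircuit * shift y.toCircuit :=
  tensor_eq x y (.refl _)

theorem toCircuit_tensor_two_wire (x : PPTerm 2) :
    (tensor x wire : PPTerm 3).toCircuit = top 1 x.toCircuit :=
  Quotient.sound (.trans (.tensor_congr (.refl _) (.symm idn_one)) (.symm (top_proEq _ _)))

theorem toCircuit_tensor_tensor (x y z : PPTerm 1) :
    (tensor (tensor x y) z : PPTerm 3).toCircuit =
      top 2 x.toCircuit * shift (top 1 y.toCircuit) * shift (shift z.toCircuit) := by
  rw [tensor_eq (n := 2) x (tensor y z) (.tensor_assoc _ _ _), toCircuit_tensor_one_one, map_mul,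
    mul_assoc]

/-! ### Rewriting in context -/

theorem Step.mul_left {n : ℕ} {D D' : PPCircuit n} (h : Step D D') (X : PPCircuit n) :
    Step (X * D) (X * D') := by
  obtain ⟨d, d', rfl, rfl, h⟩ := h
  obtain ⟨x, rfl⟩ := X.exists_term
  exact ⟨_, _, rfl, rfl, .comp_right x h⟩

theorem Step.mul_right {n : ℕ} {D D' : PPCircuit n} (h : Step D D') (X : PPCircuit n) :
    Step (D * X) (D' * X) := by
  obtain ⟨d, d', rfl, rfl, h⟩ := h
  obtain ⟨x, rfl⟩ := X.exists_term
  exact ⟨_, _, rfl, rfl, .comp_left x h⟩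

theorem termStep_castWires {n m : ℕ} (h : n = m) {d d' : PPTerm n} (hd : TermStep d d') :
    TermStep (castWires h d) (castWires h d') := by
  subst h; exact hd

theorem Step.shift {n : ℕ} {D D' : PPCircuit n} (h : Step D D') :
    Step (shift D) (shift D') := by
  obtain ⟨d, d', rfl, rfl, h⟩ := h
  exact ⟨_, _, rfl, rfl, termStep_castWires _ (.tensor_right _ h)⟩

theorem Step.top {n : ℕ} {D D' : PPCircuit n} (h : Step D D') (m : ℕ) :
    Step (top m D) (top m D') := by
  obtain ⟨d, d', rfl, rfl, h⟩ := h
  exact ⟨_, _, rfl, rfl, termStep_castWires _ (.tensor_left _ h)⟩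

/-- Some rule applies. -/
def Reducible {n : ℕ} (D : PPCircuit n) : Prop := ∃ D', Step D D'

theorem Reducible.mul_left {n : ℕ} {D : PPCircuit n} (h : Reducible D) (X : PPCircuit n) :
    Reducible (X * D) := h.imp' _ fun _ h => Step.mul_left h X

theorem Reducible.mul_right {n : ℕ} {D : PPCircuit n} (h : Reducible D) (X : PPCircuit n) :
    Reducible (D * X) := h.imp' _ fun _ h => Step.mul_right h X

theorem Reducible.shift {n : ℕ} {D : PPCircuit n} (h : Reducible D) :
    Reducible (shift D) := h.imp' _ fun _ h => Step.shift h

theorem Reducible.top {n : ℕ} {D : PPCircuit n} (h : Reducible D) (m : ℕ) :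
    Reducible (top m D) := h.imp' _ fun _ h => Step.top h m

theorem Reducible.of_rule {n : ℕ} {a b : PPTerm n} (h : Rule a b) : Reducible a.toCircuit :=
  ⟨_, _, _, rfl, rfl, .rule h⟩

end PPCircuit

/-! ### Semantics -/

/-- The entries of the semantics of a term, indexed by natural numbers and padded with zeros. -/
def PPTerm.semN {n : ℕ} (d : PPTerm n) (i j : ℕ) : ℂ :=
  if h : i < n ∧ j < n then d.sem ⟨i, h.1⟩ ⟨j, h.2⟩ else 0

theorem PPTerm.semN_val {n : ℕ} (d : PPTerm n) (i j : Fin n) : d.semN i j = d.sem i j := by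
  simp [semN]

theorem PPTerm.semN_of_le_left {n : ℕ} (d : PPTerm n) {i j : ℕ} (h : n ≤ i) : d.semN i j = 0 :=
  dif_neg (by omega)

theorem PPTerm.semN_of_le_right {n : ℕ} (d : PPTerm n) {i j : ℕ} (h : n ≤ j) : d.semN i j = 0 :=
  dif_neg (by omega)

theorem PPTerm.semN_comp {n : ℕ} (a b : PPTerm n) (i j : ℕ) :
    (comp a b).semN i j = ∑ l ∈ Finset.range n, a.semN i l * b.semN l j := by
  by_cases h : i < n ∧ j < n
  · rw [Finset.sum_range, semN, dif_pos h, sem, Matrix.mul_apply]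
    refine Finset.sum_congr rfl fun l _ => ?_
    rw [semN, semN, dif_pos ⟨h.1, l.2⟩, dif_pos ⟨l.2, h.2⟩]
  · rw [semN, dif_neg h]
    refine (Finset.sum_eq_zero fun l _ => ?_).symm
    rcases not_and_or.1 h with h | h
    · rw [semN_of_le_left a (by omega), zero_mul]
    · rw [semN_of_le_right b (by omega), mul_zero]

theorem PPTerm.semN_tensor {n m : ℕ} (a : PPTerm n) (b : PPTerm m) (i j : ℕ) :
    (tensor a b).semN i j =
      a.semN i j + if n ≤ i ∧ n ≤ j then b.semN (i - n) (j - n) else 0 := by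
  by_cases h : i < n + m ∧ j < n + m
  · obtain ⟨i, rfl⟩ : ∃ i' : Fin (n + m), (i' : ℕ) = i := ⟨⟨i, h.1⟩, rfl⟩
    obtain ⟨j, rfl⟩ : ∃ j' : Fin (n + m), (j' : ℕ) = j := ⟨⟨j, h.2⟩, rfl⟩
    rw [semN_val, sem]
    refine Fin.addCases (fun i => ?_) (fun i => ?_) i <;>
      refine Fin.addCases (fun j => ?_) (fun j => ?_) j
    · simp [semN, not_le.2 i.2]
    · simp [semN, not_le.2 i.2]
    · simp [semN, not_le.2 j.2]
    · simp [semN]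
  · rw [semN, dif_neg h, semN, dif_neg (by omega)]
    split_ifs with h'
    · rw [semN, dif_neg (by omega), add_zero]
    · rw [add_zero]

theorem PPTerm.semN_wire (i j : ℕ) : wire.semN i j = if i = 0 ∧ j = 0 then 1 else 0 := by
  by_cases h : i < 1 ∧ j < 1
  · obtain ⟨rfl, rfl⟩ : i = 0 ∧ j = 0 := by omega
    simp [semN, sem]
  · rw [semN, dif_neg h, if_neg (by omega)]

theorem PPTerm.semN_empty (i j : ℕ) : empty.semN i j = 0 := dif_neg (by omega)

theorem PPTerm.semN_idn : ∀ (n i j : ℕ), (idn n).semN i j = if i < n ∧ i = j then 1 else 0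
  | 0, i, j => by rw [idn, semN_empty, if_neg (by omega)]
  | n + 1, i, j => by
    rw [idn, semN_tensor, semN_idn n, semN_wire]
    split_ifs <;> first | omega | simp

theorem PPTerm.sem_idn (n : ℕ) : (idn n).sem = 1 := by
  ext i j
  rw [← semN_val, semN_idn, Matrix.one_apply]
  simp [Fin.ext_iff]

/-- `PROEq` relates terms whose numbers of wires are only propositionally equal, so the induction
needs entries indexed by `ℕ` rather than by `Fin n`. -/
theorem PROEq.semN_eq {n m : ℕ} {a : PPTerm n} {b : PPTerm m} (h : PROEq a b) :
    a.semN = b.semN := by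
  induction h with
  | refl => rfl
  | symm _ ih => exact ih.symm
  | trans _ _ ih ih' => exact ih.trans ih'
  | comp_congr h _ ih ih' =>
    ext i j
    rw [semN_comp, semN_comp, ih, ih', h.wires_eq]
  | tensor_congr h h' ih ih' =>
    ext i j
    rw [semN_tensor, semN_tensor, ih, ih', h.wires_eq]
  | comp_assoc a b c =>
    ext i j
    simp_rw [semN_comp, Finset.sum_mul, Finset.mul_sum]
    rw [Finset.sum_comm]
    simp_rw [mul_assoc]
  | @id_comp n a =>
    ext i j
    rw [semN_comp]
    by_cases hi : i < n
    · rw [Finset.sum_eq_single_of_mem i (Finset.mem_range.2 hi)]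
      · simp [semN_idn, hi]
      · intro l _ hl
        simp [semN_idn, hl.symm]
    · rw [semN_of_le_left a (by omega)]
      exact Finset.sum_eq_zero fun l _ => by simp [semN_idn, hi]
  | @comp_id n a =>
    ext i j
    rw [semN_comp]
    by_cases hj : j < n
    · rw [Finset.sum_eq_single_of_mem j (Finset.mem_range.2 hj)]
      · simp [semN_idn, hj]
      · intro l _ hl
        simp [semN_idn, hl]
    · rw [semN_of_le_right a (by omega)]
      refine Finset.sum_eq_zero fun l hl => ?_
      have := Finset.mem_range.1 hl
      rw [semN_idn, if_neg (by omega), mul_zero]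
  | @tensor_assoc n m k a b c =>
    ext i j
    simp only [semN_tensor, Nat.sub_sub, add_assoc]
    congr 1
    split_ifs <;> first | omega | simp
  | empty_tensor a =>
    ext i j
    simp [semN_tensor, semN_empty]
  | tensor_empty a =>
    ext i j
    simp [semN_tensor, semN_empty]
  | @interchange n m a c b d =>
    ext i j
    simp only [semN_comp, semN_tensor, Finset.sum_range_add]
    congr 1
    · refine Finset.sum_congr rfl fun l hl => ?_
      have := Finset.mem_range.1 hl
      rw [if_neg (by omega), if_neg (by omega), add_zero, add_zero]
    · split_ifs with h
      · refine Finset.sum_congr rfl fun l hl => ?_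
        rw [semN_of_le_right a (by omega), semN_of_le_left c (by omega), if_pos (by omega),
          if_pos (by omega)]
        simp
      · refine Finset.sum_eq_zero fun l hl => ?_
        rw [semN_of_le_right a (by omega), semN_of_le_left c (by omega), zero_add, zero_add]
        rcases not_and_or.1 h with h | h
        · rw [if_neg (by omega), zero_mul]
        · rw [if_neg (c := n ≤ n + l ∧ n ≤ j) (by omega), mul_zero]

theorem PPTerm.sem_eq_iff {n : ℕ} {a b : PPTerm n} : a.sem = b.sem ↔ a.semN = b.semN := by
  refine ⟨fun h => ?_, fun h => ?_⟩
  · ext i j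
    rw [semN, semN, h]
  · ext i j
    rw [← semN_val, ← semN_val, h]

namespace PPCircuit

/-- The semantics of a circuit. -/
def mat {n : ℕ} : PPCircuit n →* Matrix (Fin n) (Fin n) ℂ where
  toFun := Quotient.lift PPTerm.sem fun _ _ h => sem_eq_iff.2 (PROEq.semN_eq h)
  map_one' := sem_idn n
  map_mul' := by
    rintro ⟨a⟩ ⟨b⟩
    rfl

theorem mat_toCircuit {n : ℕ} (d : PPTerm n) : mat d.toCircuit = d.sem := rfl

theorem mat_toCircuit_val {n : ℕ} (d : PPTerm n) (i j : Fin n) :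
    mat d.toCircuit i j = d.semN i j := (semN_val d i j).symm

@[simp] theorem mat_shift_zero_zero {n : ℕ} (x : PPCircuit n) : mat (shift x) 0 0 = 1 := by
  obtain ⟨x, rfl⟩ := x.exists_term
  rw [shift_toCircuit, mat_toCircuit_val, (shift_proEq x).semN_eq, semN_tensor, semN_wire]
  simp

@[simp] theorem mat_shift_zero_succ {n : ℕ} (x : PPCircuit n) (j : Fin n) :
    mat (shift x) 0 j.succ = 0 := by
  obtain ⟨x, rfl⟩ := x.exists_term
  rw [shift_toCircuit, mat_toCircuit_val, (shift_proEq x).semN_eq, semN_tensor, semN_wire]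
  simp

@[simp] theorem mat_shift_succ_zero {n : ℕ} (x : PPCircuit n) (i : Fin n) :
    mat (shift x) i.succ 0 = 0 := by
  obtain ⟨x, rfl⟩ := x.exists_term
  rw [shift_toCircuit, mat_toCircuit_val, (shift_proEq x).semN_eq, semN_tensor, semN_wire]
  simp

@[simp] theorem mat_shift_succ_succ {n : ℕ} (x : PPCircuit n) (i j : Fin n) :
    mat (shift x) i.succ j.succ = mat x i j := by
  obtain ⟨x, rfl⟩ := x.exists_term
  rw [shift_toCircuit, mat_toCircuit_val, (shift_proEq x).semN_eq, semN_tensor, semN_wire]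
  simp [mat_toCircuit_val]

theorem mat_top_phase_zero_zero (n : ℕ) (x : PPCircuit 1) :
    mat (top n x) 0 0 = mat x 0 0 := by
  obtain ⟨x, rfl⟩ := x.exists_term
  rw [top_toCircuit, mat_toCircuit_val, (top_proEq n x).semN_eq, semN_tensor, mat_toCircuit_val]
  simp

theorem mat_top_phase_zero_succ (n : ℕ) (x : PPCircuit 1) (j : Fin n) :
    mat (top n x) 0 j.succ = 0 := by
  obtain ⟨x, rfl⟩ := x.exists_term
  rw [top_toCircuit, mat_toCircuit_val, (top_proEq n x).semN_eq, semN_tensor]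
  simp [semN]

theorem mat_top_bs_zero_zero (n : ℕ) (x : PPCircuit 2) :
    mat (top n x) 0 0 = mat x 0 0 := by
  obtain ⟨x, rfl⟩ := x.exists_term
  rw [top_toCircuit, mat_toCircuit_val, (top_proEq n x).semN_eq, semN_tensor, mat_toCircuit_val]
  simp

theorem mat_top_bs_zero_one (n : ℕ) (x : PPCircuit 2) :
    mat (top n x) 0 1 = mat x 0 1 := by
  obtain ⟨x, rfl⟩ := x.exists_term
  rw [top_toCircuit, mat_toCircuit_val, (top_proEq n x).semN_eq, semN_tensor, mat_toCircuit_val]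
  simp

theorem mat_top_bs_zero_succ_succ (n : ℕ) (x : PPCircuit 2) (j : Fin n) :
    mat (top n x) 0 j.succ.succ = 0 := by
  obtain ⟨x, rfl⟩ := x.exists_term
  rw [top_toCircuit, mat_toCircuit_val, (top_proEq n x).semN_eq, semN_tensor]
  simp [semN]

theorem mat_shift_injective {n : ℕ} {x y : PPCircuit n} (h : mat (shift x) = mat (shift y)) :
    mat x = mat y := by
  ext i j
  rw [← mat_shift_succ_succ, h, mat_shift_succ_succ]

end PPCircuit

/-! ### Soundness of the rules, and unitarity. -/

theorem Rule.sem_eq {n : ℕ} {a b : PPTerm n} (h : Rule a b) : a.sem = b.sem := by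
  have hmod (ψ : ℝ) : ∃ k : ℤ, modTwoPi ψ = ψ - k * (2 * Real.pi) :=
    ⟨toIcoDiv Real.two_pi_pos 0 ψ, by rw [← zsmul_eq_mul]; rfl⟩
  have hpi : Complex.exp (Complex.I * Real.pi) = -1 := by rw [mul_comm]; exact Complex.exp_pi_mul_I
  have h2 (a b : PPTerm 1) : (tensor a b).sem = !![a.sem 0 0, 0; 0, b.sem 0 0] := by
    ext i j
    rw [← semN_val, semN_tensor]
    fin_cases i <;> fin_cases j <;> simp [semN]
  induction h with
  | phase_mod ψ hψ =>
    obtain ⟨k, hk⟩ := hmod ψ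
    have : Complex.exp (Complex.I * (modTwoPi ψ : ℝ)) = Complex.exp (Complex.I * ψ) := by
      rw [Complex.exp_eq_exp_iff_exists_int, hk]
      exact ⟨-k, by push_cast; ring⟩
    simp only [sem, this]
  | bs_mod ψ hψ =>
    obtain ⟨k, hk⟩ := hmod ψ
    simp only [sem, hk, Real.cos_sub_int_mul_two_pi, Real.sin_sub_int_mul_two_pi]
  | phase_fusion φ₁ φ₂ h₁ h₂ =>
    ext i j
    fin_cases i; fin_cases j
    simp [sem, ← Complex.exp_add]
    ring_nf
  | phase_zero =>
    ext i j
    fin_cases i; fin_cases j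
    simp [sem]
  | bs_zero =>
    rw [h2]
    ext i j
    fin_cases i <;> fin_cases j <;> simp [sem]
  | bottom_phase φ θ hφ hθ =>
    have : Complex.exp (Complex.I * φ) * Complex.exp (Complex.I * (-φ : ℝ)) = 1 := by
      rw [← Complex.exp_add, Complex.ofReal_neg, mul_neg, add_neg_cancel, Complex.exp_zero]
    -- `sem.eq_5` is the clause of `sem` for `comp` alone: the tensors have to stay folded for `h2`
    -- to turn them into explicit diagonal matrices.
    simp only [sem.eq_5, h2]
    ext i j
    fin_cases i <;> fin_cases j <;>
      simp [sem, Matrix.mul_apply, Fin.sum_univ_two, -Complex.ofReal_neg,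
        -Complex.ofReal_cos, -Complex.ofReal_sin]
    · linear_combination (-(Real.cos θ : ℂ)) * this
    · ring
    · linear_combination (-(Complex.I * Real.sin θ : ℂ)) * this
    · ring
  | top_phase_half_pi φ hφ =>
    simp only [sem.eq_5, h2]
    ext i j
    fin_cases i <;> fin_cases j <;>
      simp [sem, Matrix.mul_apply, Fin.sum_univ_two]
    ring
  | top_phase_sub_pi φ₀ θ₀ hφ hθ hθ' =>
    have : Complex.exp (Complex.I * (φ₀ - Real.pi : ℝ)) = - Complex.exp (Complex.I * φ₀) := by
      rw [Complex.ofReal_sub, mul_sub, Complex.exp_sub, hpi, div_neg, div_one]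
    simp only [sem.eq_5, h2]
    ext i j
    fin_cases i <;> fin_cases j <;>
      simp [sem, Matrix.mul_apply, Fin.sum_univ_two, this, hpi, -Complex.ofReal_sub]
  | bs_sub_pi θ₄ hθ =>
    simp only [sem.eq_5, h2]
    ext i j
    fin_cases i <;> fin_cases j <;>
      simp [sem, Matrix.mul_apply, Fin.sum_univ_two, hpi]
  | euler3 => exact Eq.symm ‹_›
  | euler2 => exact Eq.symm ‹_›

theorem TermStep.sem_eq {n : ℕ} {a b : PPTerm n} (h : TermStep a b) : a.sem = b.sem := by
  induction h with
  | rule h => exact h.sem_eq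
  | comp_left b _ ih => rw [sem, sem, ih]
  | comp_right a _ ih => rw [sem, sem, ih]
  | tensor_left b _ ih => rw [sem, sem, ih]
  | tensor_right a _ ih => rw [sem, sem, ih]

theorem Step.mat_eq {n : ℕ} {D D' : PPCircuit n} (h : Step D D') :
    mat D = mat D' := by
  obtain ⟨d, d', rfl, rfl, h⟩ := h
  exact h.sem_eq

theorem Rewrites.mat_eq {n : ℕ} {D D' : PPCircuit n} (h : Rewrites D D') :
    mat D = mat D' := by
  induction h with
  | refl => rfl
  | tail _ h ih => exact ih.trans h.mat_eq

theorem PPTerm.sem_mul_conjTranspose {n : ℕ} (d : PPTerm n) : d.sem * d.sem.conjTranspose = 1 := by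
  induction d with
  | empty => simp [sem]
  | wire => simp [sem]
  | phase φ =>
    ext i j
    fin_cases i; fin_cases j
    simp [sem, Matrix.mul_apply, ← Complex.exp_conj, ← Complex.exp_add]
  | bs θ =>
    have hI := Complex.I_sq
    have := Complex.cos_sq_add_sin_sq (θ : ℂ)
    ext i j
    fin_cases i <;> fin_cases j <;>
      simp [sem, Matrix.mul_apply, Fin.sum_univ_two, ← Complex.cos_conj, ← Complex.sin_conj]
    · linear_combination this - (Complex.sin θ) ^ 2 * hI
    · ring
    · ring
    · linear_combination this - (Complex.sin θ) ^ 2 * hI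
  | comp a b iha ihb =>
    rw [sem, Matrix.conjTranspose_mul, Matrix.mul_assoc, ← Matrix.mul_assoc b.sem, ihb,
      Matrix.one_mul, iha]
  | tensor a b iha ihb =>
    rw [sem, Matrix.conjTranspose_reindex, Matrix.reindex_apply, Matrix.reindex_apply,
      Matrix.submatrix_mul_equiv, Matrix.fromBlocks_conjTranspose, Matrix.fromBlocks_multiply]
    simp [iha, ihb]

theorem PPCircuit.mat_mul_conjTranspose {n : ℕ} (D : PPCircuit n) :
    mat D * (mat D).conjTranspose = 1 := by
  obtain ⟨d, rfl⟩ := D.exists_term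
  exact d.sem_mul_conjTranspose

/-! ### Termination -/

open Classical in
/-- The class of an angle: `2` outside `[0, 2π)`, `1` in `[π, 2π)`, `0` in `[0, π)`. -/
def angleClass (x : ℝ) : ℕ :=
  if x ∉ Set.Ico 0 (2 * Real.pi) then 2 else if Real.pi ≤ x then 1 else 0

theorem angleClass_le_two (x : ℝ) : angleClass x ≤ 2 := by
  unfold angleClass; split_ifs <;> omega

theorem angleClass_of_notMem {x : ℝ} (h : x ∉ Set.Ico 0 (2 * Real.pi)) : angleClass x = 2 :=
  if_pos h

theorem angleClass_le_one {x : ℝ} (h : x ∈ Set.Ico 0 (2 * Real.pi)) : angleClass x ≤ 1 := by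
  unfold angleClass; rw [if_neg (not_not.2 h)]; split_ifs <;> omega

theorem angleClass_of_mem_Ico {x : ℝ} (h : x ∈ Set.Ico 0 Real.pi) : angleClass x = 0 := by
  rw [angleClass, if_neg (not_not.2 ⟨h.1, by linarith [h.1, h.2]⟩), if_neg (not_le.2 h.2)]

theorem angleClass_of_pi_le {x : ℝ} (h : Real.pi ≤ x) : 1 ≤ angleClass x := by
  unfold angleClass; rw [if_pos h]; split_ifs <;> omega

theorem modTwoPi_mem (x : ℝ) : modTwoPi x ∈ Set.Ico 0 (2 * Real.pi) := by
  have := toIcoMod_mem_Ico Real.two_pi_pos 0 x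
  rwa [zero_add] at this

namespace PPTerm

/-- The number of beam splitters. -/
def bsCount : {n : ℕ} → PPTerm n → ℕ
  | _, empty => 0
  | _, wire => 0
  | _, phase _ => 0
  | _, bs _ => 1
  | _, comp a b => bsCount a + bsCount b
  | _, tensor a b => bsCount a + bsCount b

/-- The sum over the beam splitters of their height above the bottom of the circuit. -/
def bsHeight : {n : ℕ} → PPTerm n → ℕ
  | _, empty => 0
  | _, wire => 0
  | _, phase _ => 0
  | _, bs _ => 1
  | _, comp a b => bsHeight a + bsHeight b
  | _, @tensor _ m a b => bsHeight a + m * bsCount a + bsHeight b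

/-- The sum of the classes of the angles of the beam splitters. -/
def bsClass : {n : ℕ} → PPTerm n → ℕ
  | _, empty => 0
  | _, wire => 0
  | _, phase _ => 0
  | _, bs θ => angleClass θ
  | _, comp a b => bsClass a + bsClass b
  | _, tensor a b => bsClass a + bsClass b

/-- Given the weights of the output wires, the weights of the input wires. -/
def weight : {n : ℕ} → PPTerm n → (ℕ → ℕ) → ℕ → ℕ
  | _, empty, w, i => w i
  | _, wire, w, i => w i
  | _, phase _, w, i => w i
  | _, bs _, w, i =>
      if i = 0 then 6 * w 1 + 6 else if i = 1 then 14 * w 1 + 2 * w 0 + 18 else w i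
  | _, comp a b, w, i => weight b (weight a w) i
  | _, @tensor n _ a b, w, i =>
      if i < n then weight a w i else weight b (fun j => w (n + j)) (i - n)

/-- Given the weights of the output wires, the weighted sum of the costs of the phase shifters. -/
def phaseCost : {n : ℕ} → PPTerm n → (ℕ → ℕ) → ℕ
  | _, empty, _ => 0
  | _, wire, _ => 0
  | _, phase φ, w => (4 + angleClass φ) * (w 0 + 1)
  | _, bs _, _ => 0
  | _, comp a b, w => phaseCost a w + phaseCost b (weight a w)
  | _, @tensor n _ a b, w => phaseCost a w + phaseCost b (fun j => w (n + j))

/-- Weights outside the wires of the term are junk. The two sides of interchange feed their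
components functions that agree only on the actual wires, so this locality is needed for invariance
under deformation. -/
theorem weight_congr {n : ℕ} (d : PPTerm n) {w w' : ℕ → ℕ} (h : ∀ i < n, w i = w' i) :
    ∀ i < n, weight d w i = weight d w' i := by
  induction d generalizing w w' with
  | empty => exact h
  | wire => exact h
  | phase => exact h
  | bs θ =>
    intro i _
    simp only [weight, h 0 (by omega), h 1 (by omega)]
    split_ifs <;> first | rfl | exact h _ ‹_›
  | comp a b iha ihb => exact ihb (iha h)
  | tensor a b iha ihb =>
    intro i hi
    simp only [weight]
    split_ifs with h'
    · exact iha (fun i hi => h i (by omega)) i h'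
    · exact ihb (fun i hi => h _ (by omega)) _ (by omega)

theorem phaseCost_congr {n : ℕ} (d : PPTerm n) {w w' : ℕ → ℕ} (h : ∀ i < n, w i = w' i) :
    phaseCost d w = phaseCost d w' := by
  induction d generalizing w w' with
  | empty => rfl
  | wire => rfl
  | phase => simp only [phaseCost, h 0 (by omega)]
  | bs θ => rfl
  | comp a b iha ihb =>
    simp only [phaseCost]
    rw [iha h, ihb (weight_congr a h)]
  | tensor a b iha ihb =>
    simp only [phaseCost]
    rw [iha fun i hi => h i (by omega), ihb fun i hi => h _ (by omega)]

theorem weight_idn : ∀ (n : ℕ) (w : ℕ → ℕ), weight (idn n) w = w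
  | 0, w => rfl
  | n + 1, w => by
    ext i
    simp only [idn, weight, weight_idn n]
    split_ifs
    · rfl
    · congr 1; omega

theorem phaseCost_idn : ∀ (n : ℕ) (w : ℕ → ℕ), phaseCost (idn n) w = 0
  | 0, _ => rfl
  | n + 1, w => by simp only [idn, phaseCost, phaseCost_idn n]

theorem bsCount_idn : ∀ n, bsCount (idn n) = 0
  | 0 => rfl
  | n + 1 => by simp only [idn, bsCount, bsCount_idn n]

theorem bsHeight_idn : ∀ n, bsHeight (idn n) = 0
  | 0 => rfl
  | n + 1 => by simp only [idn, bsHeight, bsHeight_idn n, bsCount_idn n]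

theorem bsClass_idn : ∀ n, bsClass (idn n) = 0
  | 0 => rfl
  | n + 1 => by simp only [idn, bsClass, bsClass_idn n]

end PPTerm

/-! ### Invariance of the measure under deformation. -/

theorem PROEq.bsCount_eq {n m : ℕ} {a : PPTerm n} {b : PPTerm m} (h : PROEq a b) :
    bsCount a = bsCount b := by
  induction h <;> (try simp only [bsCount, bsCount_idn]) <;> omega

theorem PROEq.bsHeight_eq {n m : ℕ} {a : PPTerm n} {b : PPTerm m} (h : PROEq a b) :
    bsHeight a = bsHeight b := by
  induction h with
  | tensor_congr h h' ih ih' =>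
    simp only [bsHeight, ih, ih', h.bsCount_eq, h'.wires_eq]
  | tensor_assoc => simp only [bsHeight, bsCount]; ring
  | interchange => simp only [bsHeight, bsCount]; ring
  | _ => (try simp only [bsHeight, bsHeight_idn, bsCount]) <;> omega

theorem PROEq.bsClass_eq {n m : ℕ} {a : PPTerm n} {b : PPTerm m} (h : PROEq a b) :
    bsClass a = bsClass b := by
  induction h <;> (try simp only [bsClass, bsClass_idn]) <;> omega

theorem PROEq.weight_eq {n m : ℕ} {a : PPTerm n} {b : PPTerm m} (h : PROEq a b) :
    ∀ (w : ℕ → ℕ), ∀ i < n, weight a w i = weight b w i := by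
  induction h with
  | refl => intros; rfl
  | symm h ih => exact fun w i hi => (ih w i (h.wires_eq ▸ hi)).symm
  | trans h _ ih ih' => exact fun w i hi => (ih w i hi).trans (ih' w i (h.wires_eq ▸ hi))
  | comp_congr h h' ih ih' =>
    intro w i hi
    simp only [weight]
    rw [weight_congr _ (ih w) i hi, ih' _ i hi]
  | tensor_congr h h' ih ih' =>
    intro w i hi
    simp only [weight, ← h.wires_eq]
    split_ifs with h1
    · exact ih w i h1
    · exact ih' _ _ (by omega)
  | comp_assoc => intros; rfl
  | id_comp => intros; simp only [weight, weight_idn]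
  | comp_id => intros; simp only [weight, weight_idn]
  | tensor_assoc =>
    intro w i hi
    simp only [weight, Nat.sub_sub, add_assoc]
    split_ifs <;> omega
  | empty_tensor => intros; simp [weight]
  | tensor_empty =>
    intro w i hi
    simp only [weight]
    exact if_pos hi
  | @interchange n m a c b d =>
    intro w i hi
    simp only [weight]
    split_ifs with h1
    · exact weight_congr c (fun i hi => by simp [hi]) i h1
    · exact weight_congr d (fun i hi => by simp) _ (by omega)

theorem PROEq.phaseCost_eq {n m : ℕ} {a : PPTerm n} {b : PPTerm m} (h : PROEq a b) :
    ∀ (w : ℕ → ℕ), phaseCost a w = phaseCost b w := by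
  induction h with
  | refl => intros; rfl
  | symm h ih => exact fun w => (ih w).symm
  | trans h _ ih ih' => exact fun w => (ih w).trans (ih' w)
  | comp_congr h h' ih ih' =>
    intro w
    simp only [phaseCost]
    rw [ih, phaseCost_congr _ (h.weight_eq w), ih']
  | tensor_congr h h' ih ih' =>
    intro w
    simp only [phaseCost, ← h.wires_eq, ih, ih']
  | comp_assoc => intros; simp only [phaseCost, weight, add_assoc]
  | id_comp => intros; simp only [phaseCost, weight_idn, phaseCost_idn, zero_add]
  | comp_id => intros; simp only [phaseCost, phaseCost_idn, add_zero]
  | tensor_assoc => intros; simp only [phaseCost, add_assoc]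
  | empty_tensor => intros; simp [phaseCost]
  | tensor_empty => intros; simp [phaseCost]
  | @interchange n m a c b d =>
    intro w
    simp only [phaseCost]
    rw [phaseCost_congr c (w' := weight a w) fun i hi => by simp [weight, hi],
      phaseCost_congr d (w' := weight b fun j => w (n + j)) fun i hi => by simp [weight]]
    ring

/-- The kinds of decrease that a rewriting step can cause. -/
def Decreases {n : ℕ} (a b : PPTerm n) : Prop :=
  (bsHeight b < bsHeight a ∧ bsCount b ≤ bsCount a) ∨
  (bsHeight b = bsHeight a ∧ bsCount b = bsCount a ∧ bsClass b < bsClass a) ∨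
  (bsHeight b = bsHeight a ∧ bsCount b = bsCount a ∧ bsClass b = bsClass a ∧
    weight b = weight a ∧ ∀ w, phaseCost b w < phaseCost a w)

/-- A phase shifter costs between 4 and 6 times its weight plus one, so fusing two (at least 8
units) into one (at most 6) is a gain. Before a beam splitter with output weights `w 0`, `w 1`, the
factor is `6 * w 1 + 7` on top and `14 * w 1 + 2 * w 0 + 19` at the bottom. The bottom factor
dominates the cost of the three phases created by `bottom_phase`; the top factor exceeds that of a
phase pushed to the lower output. -/
theorem Rule.decreases {n : ℕ} {a b : PPTerm n} (h : Rule a b) : Decreases a b := by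
  induction h with
  | phase_mod ψ hψ =>
    refine .inr (.inr ⟨rfl, rfl, rfl, rfl, fun w => ?_⟩)
    have h1 := angleClass_of_notMem hψ
    have h2 := angleClass_le_one (modTwoPi_mem ψ)
    exact Nat.mul_lt_mul_of_pos_right (by omega) (by omega)
  | bs_mod ψ hψ =>
    refine .inr (.inl ⟨rfl, rfl, ?_⟩)
    have h1 := angleClass_of_notMem hψ
    have h2 := angleClass_le_one (modTwoPi_mem ψ)
    simp only [bsClass]; omega
  | phase_fusion φ₁ φ₂ h₁ h₂ =>
    refine .inr (.inr ⟨rfl, rfl, rfl, rfl, fun w => ?_⟩)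
    have := angleClass_le_two (φ₁ + φ₂)
    simp only [phaseCost, weight, ← add_mul]
    exact Nat.mul_lt_mul_of_pos_right (by omega) (by omega)
  | phase_zero => exact .inr (.inr ⟨rfl, rfl, rfl, rfl, fun w => by simp [phaseCost]⟩)
  | bs_zero => exact .inl ⟨by simp [bsHeight, bsCount], by simp [bsCount]⟩
  | bottom_phase φ θ hφ hθ =>
    refine .inr (.inr ⟨rfl, rfl, by simp [bsClass], ?_, fun w => ?_⟩)
    · ext w i
      simp only [weight]
      split_ifs <;> first | omega | rfl | (congr 1; omega)
    · have h1 := angleClass_le_one ⟨hφ.1.le, hφ.2⟩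
      have h2 := angleClass_le_two (-φ)
      simp [phaseCost, weight]
      nlinarith
  | top_phase_half_pi φ hφ =>
    refine .inr (.inr ⟨rfl, rfl, by simp [bsClass], ?_, fun w => ?_⟩)
    · ext w i
      simp only [weight]
      split_ifs <;> first | omega | rfl
    · simp [phaseCost, weight]
      nlinarith
  | top_phase_sub_pi φ₀ θ₀ hφ hθ hθ' =>
    refine .inr (.inr ⟨rfl, rfl, ?_, ?_, fun w => ?_⟩)
    · simp only [bsClass]
      rw [angleClass_of_mem_Ico ⟨hθ.1.le, hθ.2⟩,
        angleClass_of_mem_Ico ⟨by linarith [hθ.2], by linarith [hθ.1]⟩]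
    · ext w i
      simp only [weight]
      split_ifs <;> first | omega | rfl | (congr 1; omega)
    -- Subtracting `π` lowers the class of the top phase to `0`, which frees at least `6 * w 1 + 7`;
    -- the new phase `π` below costs at most `5 * (w 1 + 1)`.
    · have h1 := angleClass_of_pi_le hφ.1
      have h2 : angleClass (φ₀ - Real.pi) = 0 :=
        angleClass_of_mem_Ico ⟨by linarith [hφ.1], by linarith [hφ.2]⟩
      have h3 : angleClass Real.pi ≤ 1 :=
        angleClass_le_one ⟨Real.pi_pos.le, by linarith [Real.pi_pos]⟩
      simp [phaseCost, weight, h2]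
      nlinarith
  | bs_sub_pi θ₄ hθ =>
    refine .inr (.inl ⟨rfl, rfl, ?_⟩)
    have h1 := angleClass_of_pi_le hθ.1
    have h2 : angleClass (θ₄ - Real.pi) = 0 :=
      angleClass_of_mem_Ico ⟨by linarith [hθ.1], by linarith [hθ.2]⟩
    simp only [bsClass]; omega
  | euler3 θ₁ θ₂ θ₃ φ₁ φ₂ =>
    -- The heights 2 + 1 + 2 become 1 + 2 + 1, with the number of beam splitters unchanged.
    refine .inl ?_
    cases φ₁ <;> cases φ₂ <;>
      simp [threeBS, triangle3, bsHeight, bsCount, optPhase]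
  | euler2 θ₁ θ₂ φ =>
    refine .inl ?_
    cases φ <;> simp [twoBS, triangle2, bsHeight, bsCount, optPhase]

/-- Contexts explain the side conditions in `Decreases`. Wires added below raise every beam
splitter, so a drop in height survives only if the count does not grow. A circuit composed before
the redex sees it only through `weight`, which must therefore be unchanged when the phase cost is
what decreases; a circuit composed after it changes the incoming weights, whence the quantifier over
`w`. -/
theorem TermStep.decreases {n : ℕ} {a b : PPTerm n} (h : TermStep a b) : Decreases a b := by
  induction h with
  | rule h => exact h.decreases
  | comp_left c _ ih =>
    rcases ih with ⟨h1, h2⟩ | ⟨h1, h2, h3⟩ | ⟨h1, h2, h3, h4, h5⟩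
    · exact .inl ⟨by simp only [bsHeight]; omega, by simp only [bsCount]; omega⟩
    · exact .inr (.inl ⟨by simp only [bsHeight]; omega, by simp only [bsCount]; omega,
        by simp only [bsClass]; omega⟩)
    · refine .inr (.inr ⟨by simp only [bsHeight]; omega, by simp only [bsCount]; omega,
        by simp only [bsClass]; omega, by ext; simp only [weight, h4], fun w => ?_⟩)
      simp only [phaseCost, h4]
      have := h5 w
      omega
  | comp_right c _ ih =>
    rcases ih with ⟨h1, h2⟩ | ⟨h1, h2, h3⟩ | ⟨h1, h2, h3, h4, h5⟩
    · exact .inl ⟨by simp only [bsHeight]; omega, by simp only [bsCount]; omega⟩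
    · exact .inr (.inl ⟨by simp only [bsHeight]; omega, by simp only [bsCount]; omega,
        by simp only [bsClass]; omega⟩)
    · refine .inr (.inr ⟨by simp only [bsHeight]; omega, by simp only [bsCount]; omega,
        by simp only [bsClass]; omega, by ext; simp only [weight, h4], fun w => ?_⟩)
      simp only [phaseCost]
      have := h5 (weight c w)
      omega
  | @tensor_left _ m _ _ c _ ih =>
    rcases ih with ⟨h1, h2⟩ | ⟨h1, h2, h3⟩ | ⟨h1, h2, h3, h4, h5⟩
    · refine .inl ⟨?_, by simp only [bsCount]; omega⟩
      have := Nat.mul_le_mul_left m h2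
      simp only [bsHeight]; omega
    · exact .inr (.inl ⟨by simp only [bsHeight, h1, h2], by simp only [bsCount]; omega,
        by simp only [bsClass]; omega⟩)
    · refine .inr (.inr ⟨by simp only [bsHeight, h1, h2], by simp only [bsCount]; omega,
        by simp only [bsClass]; omega, by ext; simp only [weight, h4], fun w => ?_⟩)
      simp only [phaseCost]
      have := h5 w
      omega
  | @tensor_right n _ c _ _ _ ih =>
    rcases ih with ⟨h1, h2⟩ | ⟨h1, h2, h3⟩ | ⟨h1, h2, h3, h4, h5⟩
    · exact .inl ⟨by simp only [bsHeight]; omega, by simp only [bsCount]; omega⟩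
    · exact .inr (.inl ⟨by simp only [bsHeight]; omega, by simp only [bsCount]; omega,
        by simp only [bsClass]; omega⟩)
    · refine .inr (.inr ⟨by simp only [bsHeight]; omega, by simp only [bsCount]; omega,
        by simp only [bsClass]; omega, by ext; simp only [weight, h4], fun w => ?_⟩)
      simp only [phaseCost]
      have := h5 fun j => w (n + j)
      omega

/-- The termination measure of a circuit, ordered lexicographically. -/
def PPCircuit.measure {n : ℕ} : PPCircuit n → ℕ ×ₗ ℕ ×ₗ ℕ :=
  Quotient.lift (fun d => toLex (bsHeight d, toLex (bsClass d, phaseCost d fun _ => 0)))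
    fun a b (h : PROEq a b) => by rw [h.bsHeight_eq, h.bsClass_eq, h.phaseCost_eq]

theorem Step.measure_lt {n : ℕ} {D D' : PPCircuit n} (h : Step D D') :
    D'.measure < D.measure := by
  obtain ⟨d, d', rfl, rfl, h⟩ := h
  change toLex (bsHeight d', toLex (bsClass d', phaseCost d' fun _ => 0)) <
    toLex (bsHeight d, toLex (bsClass d, phaseCost d fun _ => 0))
  rcases h.decreases with ⟨h1, -⟩ | ⟨h1, -, h3⟩ | ⟨h1, -, h3, -, h5⟩
  · exact Prod.Lex.toLex_lt_toLex.2 (.inl h1)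
  · exact Prod.Lex.toLex_lt_toLex.2 (.inr ⟨h1, Prod.Lex.toLex_lt_toLex.2 (.inl h3)⟩)
  · exact Prod.Lex.toLex_lt_toLex.2 (.inr ⟨h1, Prod.Lex.toLex_lt_toLex.2 (.inr ⟨h3, h5 _⟩)⟩)

theorem stronglyNormalising {n : ℕ} (D : PPCircuit n) : StronglyNormalising D := by
  rintro ⟨s, -, hs⟩
  exact not_strictAnti_of_wellFoundedLT (fun k => (s k).measure)
    (strictAnti_nat_of_succ_lt fun k => (hs k).measure_lt)

theorem exists_irreducible {n : ℕ} (D : PPCircuit n) : ∃ N, Rewrites D N ∧ IsIrreducible N := by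
  induction D using (InvImage.wf PPCircuit.measure wellFounded_lt).induction with
  | _ D ih =>
    by_cases h : IsIrreducible D
    · exact ⟨D, .refl, h⟩
    · simp only [IsIrreducible, not_forall, not_not] at h
      obtain ⟨D', h⟩ := h
      obtain ⟨N, hN, hN'⟩ := ih D' h.measure_lt
      exact ⟨N, .head h hN, hN'⟩

/-! ### Triangles, recursively -/

namespace PPCircuit

/-- The starred phase shifter. -/
def sP (φ : ℝ) : PPCircuit 1 := if φ = 0 then 1 else P φ

/-- The starred beam splitter. -/
def sB (θ : ℝ) : PPCircuit 2 := if θ = 0 then 1 else B θ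

@[simp] theorem sP_zero : sP 0 = 1 := if_pos rfl

@[simp] theorem sB_zero : sB 0 = 1 := if_pos rfl

theorem sP_of_ne_zero {φ : ℝ} (h : φ ≠ 0) : sP φ = P φ := if_neg h

theorem sB_of_ne_zero {θ : ℝ} (h : θ ≠ 0) : sB θ = B θ := if_neg h

/-- An antidiagonal on `n + 1` wires, without its last phase. -/
def anti : (n : ℕ) → (a b : ℕ → ℝ) → PPCircuit (n + 1)
  | 0, _, _ => 1
  | n + 1, a, b => top n (sB (a 0) * top 1 (sP (b 0))) *
      shift (anti n (fun j => a (j + 1)) fun j => b (j + 1))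

/-- The triangle, defined by recursion on the number of wires. -/
def tri : (n : ℕ) → (α β : ℕ → ℕ → ℝ) → (γ : ℕ → ℝ) → PPCircuit n
  | 0, _, _, _ => 1
  | n + 1, α, β, γ => shift (tri n (fun i => α (i + 1)) (fun i => β (i + 1)) fun i => γ (i + 1)) *
      top n (sP (γ 0)) * anti n (α 0) (β 0)

theorem place_succ_proEq (n k : ℕ) {a : ℕ} (g : PPTerm a) :
    PROEq (place (n + 1) (k + 1) g) (place n k g).shift := by
  unfold place
  split_ifs with h h'
  · refine .trans (castWires_proEq _ _) (.trans ?_ (.symm (.trans (shift_proEq _)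
      (.tensor_congr (.refl _) (castWires_proEq _ _)))))
    refine .trans ?_ (.tensor_assoc _ _ _)
    refine .tensor_congr (.trans ?_ (.tensor_assoc _ _ _)) (idn_congr (by omega))
    exact .tensor_congr (.symm (wire_tensor_idn k)) (.refl _)
  · omega
  · omega
  · exact .symm (.trans (shift_proEq _) (wire_tensor_idn n))

theorem place_succ (n k : ℕ) {a : ℕ} (g : PPTerm a) :
    (place (n + 1) (k + 1) g).toCircuit = shift (place n k g).toCircuit :=
  Quotient.sound (place_succ_proEq n k g)

theorem place_zero (n : ℕ) {a : ℕ} (g : PPTerm a) :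
    (place (n + a) 0 g).toCircuit = top n g.toCircuit := by
  refine Quotient.sound ?_
  change PROEq _ _
  rw [place, dif_pos (by omega)]
  exact .trans (castWires_proEq _ _) (.trans (.tensor_congr (.empty_tensor _)
    (idn_congr (by omega))) (.symm (top_proEq _ _)))

theorem starPhase_succ (n k : ℕ) (φ : ℝ) :
    (starPhase (n + 1) (k + 1) φ).toCircuit = shift (starPhase n k φ).toCircuit := by
  unfold starPhase
  split_ifs
  · simp only [toCircuit_idn, map_one]
  · exact place_succ _ _ _

theorem starBS_succ (n k : ℕ) (θ : ℝ) :
    (starBS (n + 1) (k + 1) θ).toCircuit = shift (starBS n k θ).toCircuit := by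
  unfold starBS
  split_ifs
  · simp only [toCircuit_idn, map_one]
  · exact place_succ _ _ _

theorem starPhase_zero (n : ℕ) (φ : ℝ) :
    (starPhase (n + 1) 0 φ).toCircuit = top n (sP φ) := by
  unfold starPhase sP
  split_ifs
  · simp only [toCircuit_idn, map_one]
  · exact place_zero n (phase φ)

theorem starBS_zero (n : ℕ) (θ : ℝ) :
    (starBS (n + 2) 0 θ).toCircuit = top n (sB θ) := by
  unfold starBS sB
  split_ifs
  · simp only [toCircuit_idn, map_one]
  · exact place_zero n (bs θ)

/-- The list is ordered by time while the monoid product runs backwards, hence the reversal. -/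
theorem toCircuit_seqAll (n : ℕ) : ∀ l : List (PPTerm n),
    (seqAll n l).toCircuit = (l.reverse.map toCircuit).prod
  | [] => rfl
  | d :: l => by
    rw [seqAll, toCircuit_comp, toCircuit_seqAll n l]
    simp

theorem anti_eq_prod (n : ℕ) (a b : ℕ → ℝ) :
    anti n a b = ((List.range n).map fun j =>
      (comp (starBS (n + 1) j (a j)) (starPhase (n + 1) j (b j))).toCircuit).prod := by
  induction n generalizing a b with
  | zero => rfl
  | succ n ih =>
    rw [anti, ih, List.range_succ_eq_map, List.map_cons, List.prod_cons, List.map_map,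
      map_list_prod, List.map_map, toCircuit_comp, starBS_zero, starPhase_zero, map_mul,
      top_top_one_phase]
    simp only [Function.comp_def, toCircuit_comp, starBS_succ, starPhase_succ, map_mul,
      Nat.succ_eq_add_one]

theorem toCircuit_antidiagonal (n : ℕ) (α β : ℕ → ℕ → ℝ) (γ : ℕ → ℝ) (i : ℕ) :
    (antidiagonal n α β γ i).toCircuit = (starPhase n i (γ i)).toCircuit *
      ((List.range (n - 1 - i)).map fun j =>
        (comp (starBS n (i + j) (α i j)) (starPhase n (i + j) (β i j))).toCircuit).prod := by
  rw [antidiagonal, toCircuit_seqAll]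
  simp [Function.comp_def, List.map_reverse]

theorem antidiagonal_zero (n : ℕ) (α β : ℕ → ℕ → ℝ) (γ : ℕ → ℝ) :
    (antidiagonal (n + 1) α β γ 0).toCircuit = top n (sP (γ 0)) * anti n (α 0) (β 0) := by
  rw [toCircuit_antidiagonal, starPhase_zero, anti_eq_prod]
  simp

theorem antidiagonal_succ (n : ℕ) (α β : ℕ → ℕ → ℝ) (γ : ℕ → ℝ) (i : ℕ) :
    (antidiagonal (n + 1) α β γ (i + 1)).toCircuit =
      shift (antidiagonal n (fun i => α (i + 1)) (fun i => β (i + 1)) (fun i => γ (i + 1))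
        i).toCircuit := by
  rw [toCircuit_antidiagonal, toCircuit_antidiagonal, map_mul, map_list_prod, List.map_map,
    starPhase_succ, show n + 1 - 1 - (i + 1) = n - 1 - i by omega]
  simp only [Function.comp_def, toCircuit_comp, map_mul, Nat.add_right_comm i 1, starBS_succ,
    starPhase_succ]

/-- Links the triangle as a list of antidiagonals to its recursive form, whose block `shift (tri n
…)` leaves the first row of a matrix untouched and so suits induction on the number of wires. -/
theorem toCircuit_triangle (n : ℕ) (α β : ℕ → ℕ → ℝ) (γ : ℕ → ℝ) :
    (triangle n α β γ).toCircuit = tri n α β γ := by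
  induction n generalizing α β γ with
  | zero => rfl
  | succ n ih =>
    rw [tri, ← ih, triangle, triangle, toCircuit_seqAll, toCircuit_seqAll, List.range_succ_eq_map,
      mul_assoc, ← antidiagonal_zero, map_list_prod]
    simp [Function.comp_def, antidiagonal_succ, List.map_reverse]

/-- The conditions on the angles of an antidiagonal on `n + 1` wires. -/
def AntiAngles (n : ℕ) (a b : ℕ → ℝ) : Prop :=
  ∀ j < n, a j ∈ Set.Ico 0 Real.pi ∧ b j ∈ Set.Ico 0 Real.pi ∧
    (a j = 0 → ∀ j', j < j' → j' < n → a j' = 0) ∧ (a j = 0 ∨ a j = Real.pi / 2 → b j = 0)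

theorem triangleAngles_succ {n : ℕ} {α β : ℕ → ℕ → ℝ} {γ : ℕ → ℝ} :
    TriangleAngles (n + 1) α β γ ↔ AntiAngles n (α 0) (β 0) ∧ γ 0 ∈ Set.Ico 0 (2 * Real.pi) ∧
      TriangleAngles n (fun i => α (i + 1)) (fun i => β (i + 1)) fun i => γ (i + 1) := by
  constructor
  · rintro ⟨h, h'⟩
    refine ⟨fun j hj => ?_, h' 0 (by omega), fun i j hij => ?_, fun i hi => h' _ (by omega)⟩
    · obtain ⟨h1, h2, h3, h4⟩ := h 0 j (by omega)
      exact ⟨h1, h2, fun h j' hj hj' => h3 h j' hj (by omega), h4⟩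
    · obtain ⟨h1, h2, h3, h4⟩ := h (i + 1) j (by omega)
      exact ⟨h1, h2, fun h j' hj hj' => h3 h j' hj (by omega), h4⟩
  · rintro ⟨h, hγ, h', hγ'⟩
    refine ⟨fun i j hij => ?_, fun i hi => ?_⟩
    · cases i with
      | zero =>
        obtain ⟨h1, h2, h3, h4⟩ := h j (by omega)
        exact ⟨h1, h2, fun h j' hj hj' => h3 h j' hj (by omega), h4⟩
      | succ i =>
        obtain ⟨h1, h2, h3, h4⟩ := h' i j (by omega)
        exact ⟨h1, h2, fun h j' hj hj' => h3 h j' hj (by omega), h4⟩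
    · cases i with
      | zero => exact hγ
      | succ i => exact hγ' i (by omega)

theorem antiAngles_succ {n : ℕ} {a b : ℕ → ℝ} :
    AntiAngles (n + 1) a b ↔ a 0 ∈ Set.Ico 0 Real.pi ∧ b 0 ∈ Set.Ico 0 Real.pi ∧
      (a 0 = 0 ∨ a 0 = Real.pi / 2 → b 0 = 0) ∧ (a 0 = 0 → ∀ j < n, a (j + 1) = 0) ∧
      AntiAngles n (fun j => a (j + 1)) fun j => b (j + 1) := by
  constructor
  · intro h
    obtain ⟨h1, h2, h3, h4⟩ := h 0 (by omega)
    refine ⟨h1, h2, h4, fun h j hj => h3 h _ (by omega) (by omega), fun j hj => ?_⟩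
    obtain ⟨h1, h2, h3, h4⟩ := h (j + 1) (by omega)
    exact ⟨h1, h2, fun h j' hj hj' => h3 h _ (by omega) (by omega), h4⟩
  · rintro ⟨h1, h2, h3, h4, h⟩ j hj
    cases j with
    | zero =>
      refine ⟨h1, h2, fun h0 j' hj hj' => ?_, h3⟩
      obtain ⟨j', rfl⟩ := Nat.exists_eq_add_of_lt hj
      exact h4 h0 _ (by omega)
    | succ j =>
      obtain ⟨h1, h2, h3, h4⟩ := h j (by omega)
      refine ⟨h1, h2, fun h0 j' hj hj' => ?_, h4⟩
      obtain ⟨k, rfl⟩ : ∃ k, j' = k + 1 := ⟨j' - 1, by omega⟩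
      exact h3 h0 k (by omega) (by omega)

/-- A sequence with a given head and tail. -/
def consSeq {X : Type*} (x : X) (f : ℕ → X) : ℕ → X
  | 0 => x
  | n + 1 => f n

theorem isTriangularNF_iff {n : ℕ} {N : PPCircuit n} :
    IsTriangularNF N ↔ ∃ α β γ, TriangleAngles n α β γ ∧ N = tri n α β γ := by
  simp only [IsTriangularNF, toCircuit_triangle]

/-- The form in which triangles are used from here on: a smaller triangle below, after one
antidiagonal and its final phase. -/
theorem isTriangularNF_succ {n : ℕ} {N : PPCircuit (n + 1)} :
    IsTriangularNF N ↔ ∃ T a b, ∃ c ∈ Set.Ico 0 (2 * Real.pi), IsTriangularNF T ∧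
      AntiAngles n a b ∧ N = shift T * top n (sP c) * anti n a b := by
  simp only [isTriangularNF_iff]
  constructor
  · rintro ⟨α, β, γ, h, rfl⟩
    obtain ⟨h1, h2, h3⟩ := triangleAngles_succ.1 h
    exact ⟨_, _, _, _, h2, ⟨_, _, _, h3, rfl⟩, h1, rfl⟩
  · rintro ⟨_, a, b, c, hc, ⟨α, β, γ, h, rfl⟩, hab, rfl⟩
    exact ⟨consSeq a α, consSeq b β, consSeq c γ, triangleAngles_succ.2 ⟨hab, hc, h⟩, rfl⟩

theorem isTriangularNF_zero (N : PPCircuit 0) : IsTriangularNF N ↔ N = 1 := by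
  rw [isTriangularNF_iff]
  refine ⟨fun ⟨_, _, _, _, h⟩ => h, fun h => ⟨fun _ _ => 0, fun _ _ => 0, fun _ => 0, ?_, h⟩⟩
  exact ⟨fun i j h => by omega, fun i h => by omega⟩

theorem anti_congr {n : ℕ} {a b a' b' : ℕ → ℝ} (h : ∀ j < n, a j = a' j ∧ b j = b' j) :
    anti n a b = anti n a' b' := by
  induction n generalizing a b a' b' with
  | zero => rfl
  | succ n ih =>
    rw [anti, anti, (h 0 (by omega)).1, (h 0 (by omega)).2, ih fun j hj => h _ (by omega)]

theorem anti_zero (n : ℕ) : anti n (fun _ => 0) (fun _ => 0) = 1 := by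
  induction n with
  | zero => rfl
  | succ n ih => rw [anti, ih]; simp

/-- A zero beam splitter angle forces all later ones in the antidiagonal to vanish, and each of them
forces its phase to vanish. -/
theorem AntiAngles.anti_eq_one {n : ℕ} {a b : ℕ → ℝ} (h : AntiAngles n a b)
    (h0 : n = 0 ∨ a 0 = 0) : anti n a b = 1 := by
  rw [← anti_zero n]
  refine anti_congr fun j hj => ?_
  have : a j = 0 := by
    rcases Nat.eq_zero_or_pos j with rfl | hj'
    · exact h0.resolve_left (by omega)
    · exact (h 0 (by omega)).2.2.1 (h0.resolve_left (by omega)) j hj' hj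
  exact ⟨this, (h j hj).2.2.2 (.inl this)⟩

theorem antiAngles_zero (n : ℕ) : AntiAngles n (fun _ => 0) fun _ => 0 := fun j hj => by
  simp [Real.pi_pos]

end PPCircuit

/-! ### The first row of an antidiagonal -/

theorem eq_of_exp_I_mul_eq {c c' : ℝ} (hc : c ∈ Set.Ico 0 (2 * Real.pi))
    (hc' : c' ∈ Set.Ico 0 (2 * Real.pi))
    (h : Complex.exp (Complex.I * c) = Complex.exp (Complex.I * c')) : c = c' := by
  obtain ⟨k, hk⟩ := Complex.exp_eq_exp_iff_exists_int.1 h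
  have hk' : c = c' + k * (2 * Real.pi) := by
    have : Complex.I * c = Complex.I * (c' + k * (2 * Real.pi)) := by rw [hk]; ring
    exact_mod_cast mul_left_cancel₀ Complex.I_ne_zero this
  have hpi := Real.pi_pos
  have h1 : (k : ℝ) < 1 := by
    by_contra! hcon
    nlinarith [hc.1, hc.2, hc'.1, hc'.2]
  have h2 : (-1 : ℝ) < k := by
    by_contra! hcon
    nlinarith [hc.1, hc.2, hc'.1, hc'.2]
  have h3 : k = 0 := by
    have h1' : k < 1 := by exact_mod_cast h1
    have h2' : -1 < k := by exact_mod_cast h2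
    omega
  simpa [h3] using hk'

theorem exists_exp_I_mul_eq {z : ℂ} (hz : ‖z‖ = 1) :
    ∃ c ∈ Set.Ico 0 (2 * Real.pi), z = Complex.exp (Complex.I * c) := by
  refine ⟨modTwoPi z.arg, modTwoPi_mem _, ?_⟩
  have h := Complex.norm_mul_exp_arg_mul_I z
  rw [hz, Complex.ofReal_one, one_mul] at h
  conv_lhs => rw [← h]
  rw [Complex.exp_eq_exp_iff_exists_int]
  refine ⟨toIcoDiv Real.two_pi_pos 0 z.arg, ?_⟩
  have h : modTwoPi z.arg = z.arg - toIcoDiv Real.two_pi_pos 0 z.arg * (2 * Real.pi) := by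
    rw [← zsmul_eq_mul]; rfl
  rw [h]
  push_cast
  ring

theorem norm_exp_I_mul (c : ℝ) : ‖Complex.exp (Complex.I * c)‖ = 1 := by
  rw [mul_comm]; exact Complex.norm_exp_ofReal_mul_I c

theorem exp_I_mul_add_pi (c : ℝ) :
    Complex.exp (Complex.I * (c + Real.pi : ℝ)) = -Complex.exp (Complex.I * c) := by
  rw [Complex.ofReal_add, mul_add, Complex.exp_add, mul_comm _ (Real.pi : ℂ),
    Complex.exp_pi_mul_I, mul_neg_one]

theorem eq_pi_div_two_of_cos_eq_zero {a : ℝ} (ha : a ∈ Set.Ico 0 Real.pi)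
    (h : Real.cos a = 0) : a = Real.pi / 2 :=
  Real.injOn_cos ⟨ha.1, ha.2.le⟩ ⟨by linarith [Real.pi_pos], by linarith [Real.pi_pos]⟩
    (h.trans Real.cos_pi_div_two.symm)

theorem eq_zero_of_sin_eq_zero {a : ℝ} (ha : a ∈ Set.Ico 0 Real.pi) (h : Real.sin a = 0) :
    a = 0 := by
  by_contra h0
  exact (Real.sin_pos_of_pos_of_lt_pi (lt_of_le_of_ne ha.1 (Ne.symm h0)) ha.2).ne' h

/-- The modulus gives `cos a` up to sign, and restricting the phase to `[0, π)` fixes the sign.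
Where the cosine vanishes the phase is lost, which is why it is required to be `0` there. -/
theorem eq_and_eq_of_exp_mul_cos_eq {a a' b b' : ℝ} (ha : a ∈ Set.Ico 0 Real.pi)
    (ha' : a' ∈ Set.Ico 0 Real.pi) (hb : b ∈ Set.Ico 0 Real.pi) (hb' : b' ∈ Set.Ico 0 Real.pi)
    (hab : a = Real.pi / 2 → b = 0) (hab' : a' = Real.pi / 2 → b' = 0)
    (h : Complex.exp (Complex.I * b) * Real.cos a = Complex.exp (Complex.I * b') * Real.cos a') :
    a = a' ∧ b = b' := by
  have hnorm : |Real.cos a| = |Real.cos a'| := by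
    have := congrArg norm h
    rwa [norm_mul, norm_mul, norm_exp_I_mul, norm_exp_I_mul, one_mul, one_mul,
      Complex.norm_real, Complex.norm_real] at this
  by_cases h0 : Real.cos a = 0
  · have h0' : Real.cos a' = 0 := by rwa [h0, abs_zero, eq_comm, abs_eq_zero] at hnorm
    have e := eq_pi_div_two_of_cos_eq_zero ha h0
    have e' := eq_pi_div_two_of_cos_eq_zero ha' h0'
    exact ⟨e.trans e'.symm, (hab e).trans (hab' e').symm⟩
  have h0c : (Real.cos a : ℂ) ≠ 0 := by exact_mod_cast h0
  rcases abs_eq_abs.1 hnorm with he | he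
  · rw [← he] at h
    exact ⟨Real.injOn_cos ⟨ha.1, ha.2.le⟩ ⟨ha'.1, ha'.2.le⟩ he,
      eq_of_exp_I_mul_eq ⟨hb.1, by linarith [hb.1, hb.2]⟩ ⟨hb'.1, by linarith [hb'.1, hb'.2]⟩
        (mul_right_cancel₀ h0c h)⟩
  -- Opposite cosines would give `b = b' + π`, which is out of range.
  · exfalso
    have he' : Real.cos a' = -Real.cos a := by linarith
    rw [he', Complex.ofReal_neg, mul_neg, ← neg_mul, ← exp_I_mul_add_pi] at h
    have := eq_of_exp_I_mul_eq ⟨hb.1, by linarith [hb.1, hb.2]⟩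
      ⟨by linarith [hb'.1, hb'.2], by linarith [hb'.1, hb'.2]⟩ (mul_right_cancel₀ h0c h)
    linarith [hb.2, hb'.1]

theorem exists_exp_mul_cos_eq {z : ℂ} (hz : ‖z‖ < 1) :
    ∃ a ∈ Set.Ioo 0 Real.pi, ∃ b ∈ Set.Ico 0 Real.pi, (a = Real.pi / 2 → b = 0) ∧
      z = Complex.exp (Complex.I * b) * Real.cos a ∧ Real.sin a = √(1 - ‖z‖ ^ 2) := by
  have hpi := Real.pi_pos
  -- Here `x` is the future `cos a`: it is `‖z‖` or `-‖z‖`, the sign being chosen so that the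
  -- remaining phase lies in `[0, π)`.
  have key (x : ℝ) (b : ℝ) (hx : |x| = ‖z‖) (hb : b ∈ Set.Ico 0 Real.pi) (hb0 : x = 0 → b = 0)
      (h : z = Complex.exp (Complex.I * b) * x) :
      ∃ a ∈ Set.Ioo 0 Real.pi, ∃ b ∈ Set.Ico 0 Real.pi, (a = Real.pi / 2 → b = 0) ∧
        z = Complex.exp (Complex.I * b) * Real.cos a ∧ Real.sin a = √(1 - ‖z‖ ^ 2) := by
    obtain ⟨h1, h2⟩ := abs_lt.1 (hx.trans_lt hz)
    have hcos := Real.cos_arccos h1.le h2.le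
    refine ⟨Real.arccos x, ⟨Real.arccos_pos.2 h2, ?_⟩, b, hb, fun h => hb0 ?_, ?_, ?_⟩
    · exact lt_of_le_of_ne (Real.arccos_le_pi x) fun h => h1.not_ge (Real.arccos_eq_pi.1 h)
    · rw [← hcos, h, Real.cos_pi_div_two]
    · rw [hcos]; exact h
    · rw [Real.sin_arccos, ← hx, sq_abs]
  have hz' : z = Complex.exp (Complex.I * z.arg) * ‖z‖ := by
    rw [mul_comm, mul_comm Complex.I]; exact (Complex.norm_mul_exp_arg_mul_I z).symm
  by_cases h0 : z = 0
  · exact key 0 0 (by simp [h0]) ⟨le_rfl, hpi⟩ (fun _ => rfl) (by simp [h0])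
  have h0' : ‖z‖ ≠ 0 := norm_ne_zero_iff.2 h0
  have h1 := Complex.arg_le_pi z
  have h2 := Complex.neg_pi_lt_arg z
  rcases lt_or_ge z.arg 0 with h | h
  · refine key (-‖z‖) (z.arg + Real.pi) (by simp) ⟨by linarith, by linarith⟩
      (fun h => absurd (neg_eq_zero.1 h) h0') ?_
    rw [exp_I_mul_add_pi, Complex.ofReal_neg, neg_mul_neg]
    exact hz'
  rcases h1.lt_or_eq with h1 | h1
  · exact key ‖z‖ z.arg (by simp) ⟨h, h1⟩ (fun h => absurd h h0') hz'
  -- The boundary value `arg z = π` is excluded from `[0, π)` and becomes phase `0` with a negative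
  -- cosine.
  · refine key (-‖z‖) 0 (by simp) ⟨le_rfl, hpi⟩ (fun h => absurd (neg_eq_zero.1 h) h0') ?_
    have := exp_I_mul_add_pi 0
    rw [zero_add] at this
    rw [h1, this] at hz'
    rw [Complex.ofReal_neg, mul_neg, ← neg_mul]
    exact hz'

namespace PPCircuit

/-- The first row of the matrix of an antidiagonal without its last phase. -/
def antiRow : (n : ℕ) → (a b : ℕ → ℝ) → Fin (n + 1) → ℂ
  | 0, _, _ => fun _ => 1
  | n + 1, a, b => Fin.cons (Complex.exp (Complex.I * b 0) * Real.cos (a 0)) fun j =>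
      Complex.I * Real.sin (a 0) * antiRow n (fun j => a (j + 1)) (fun j => b (j + 1)) j

theorem antiRow_succ_zero (n : ℕ) (a b : ℕ → ℝ) :
    antiRow (n + 1) a b 0 = Complex.exp (Complex.I * b 0) * Real.cos (a 0) := rfl

theorem antiRow_succ_succ (n : ℕ) (a b : ℕ → ℝ) (j : Fin (n + 1)) :
    antiRow (n + 1) a b j.succ =
      Complex.I * Real.sin (a 0) * antiRow n (fun j => a (j + 1)) (fun j => b (j + 1)) j := rfl

theorem mat_P (φ : ℝ) : mat (P φ) = !![Complex.exp (Complex.I * φ)] := rfl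

theorem mat_B (θ : ℝ) : mat (B θ) =
    !![(Real.cos θ : ℂ), Complex.I * (Real.sin θ : ℂ);
      Complex.I * (Real.sin θ : ℂ), (Real.cos θ : ℂ)] := rfl

theorem mat_sP (φ : ℝ) : mat (sP φ) = mat (P φ) := by
  unfold sP
  split_ifs with h
  · ext i j
    fin_cases i; fin_cases j
    simp [mat_P, h]
  · rfl

theorem mat_sB (θ : ℝ) : mat (sB θ) = mat (B θ) := by
  unfold sB
  split_ifs with h
  · ext i j
    fin_cases i <;> fin_cases j <;> simp [mat_B, h]
  · rfl

theorem mat_bs_phase_zero_zero (θ φ : ℝ) : mat (sB θ * top 1 (sP φ)) 0 0 =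
    Complex.exp (Complex.I * φ) * Real.cos θ := by
  have h1 : mat (top 1 (sP φ) : PPCircuit 2) 0 0 = _ := mat_top_phase_zero_zero 1 (sP φ)
  have h2 : mat (top 1 (sP φ) : PPCircuit 2) 1 0 = 0 := by
    obtain ⟨x, hx⟩ := (sP φ).exists_term
    rw [← hx, top_toCircuit, mat_toCircuit_val, (top_proEq 1 x).semN_eq, semN_tensor]
    simp [semN]
  rw [map_mul, Matrix.mul_apply, Fin.sum_univ_two, h1, h2, mat_sP, mat_sB, mat_P, mat_B]
  simp [mul_comm]

theorem mat_bs_phase_zero_one (θ φ : ℝ) : mat (sB θ * top 1 (sP φ)) 0 1 =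
    Complex.I * Real.sin θ := by
  have h1 : mat (top 1 (sP φ) : PPCircuit 2) 0 1 = 0 := mat_top_phase_zero_succ 1 (sP φ) 0
  have h2 : mat (top 1 (sP φ) : PPCircuit 2) 1 1 = 1 := by
    obtain ⟨x, hx⟩ := (sP φ).exists_term
    rw [← hx, top_toCircuit, mat_toCircuit_val, (top_proEq 1 x).semN_eq, semN_tensor,
      semN_idn]
    simp [semN]
  rw [map_mul, Matrix.mul_apply, Fin.sum_univ_two, h1, h2, mat_sB, mat_B]
  simp

theorem mat_anti_zero (n : ℕ) (a b : ℕ → ℝ) (j : Fin (n + 1)) :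
    mat (anti n a b) 0 j = antiRow n a b j := by
  induction n generalizing a b with
  | zero => fin_cases j; simp [anti, antiRow]
  | succ n ih =>
    rw [anti, map_mul, Matrix.mul_apply, Fin.sum_univ_succ, Fin.sum_univ_succ, Fin.succ_zero_eq_one,
      mat_top_bs_zero_zero, mat_top_bs_zero_one, mat_bs_phase_zero_zero, mat_bs_phase_zero_one]
    simp_rw [mat_top_bs_zero_succ_succ, zero_mul]
    rw [Finset.sum_const_zero, add_zero, ← Fin.succ_zero_eq_one]
    refine Fin.cases ?_ (fun j => ?_) j
    · rw [mat_shift_zero_zero, mat_shift_succ_zero, antiRow_succ_zero]; ring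
    · rw [mat_shift_zero_succ, mat_shift_succ_succ, ih, antiRow_succ_succ]; ring

theorem mat_phase_anti_zero (n : ℕ) (a b : ℕ → ℝ) (c : ℝ) (j : Fin (n + 1)) :
    mat (top n (sP c) * anti n a b) 0 j = Complex.exp (Complex.I * c) * antiRow n a b j := by
  rw [map_mul, Matrix.mul_apply, Fin.sum_univ_succ, mat_top_phase_zero_zero, mat_anti_zero,
    mat_sP, mat_P]
  simp [mat_top_phase_zero_succ]

theorem sum_norm_antiRow (n : ℕ) (a b : ℕ → ℝ) : ∑ j, ‖antiRow n a b j‖ ^ 2 = 1 := by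
  induction n generalizing a b with
  | zero => simp [antiRow]
  | succ n ih =>
    rw [Fin.sum_univ_succ, antiRow_succ_zero]
    simp_rw [antiRow_succ_succ, norm_mul, mul_pow]
    rw [← Finset.mul_sum, ih, norm_exp_I_mul, Complex.norm_real, Complex.norm_real,
      Complex.norm_I, Real.norm_eq_abs, Real.norm_eq_abs, sq_abs, sq_abs]
    linarith [Real.sin_sq_add_cos_sq (a 0)]

/-- The norm of the tail of the row is `sin (a 0)`. If it is nonzero, dividing it out leaves a
shorter row, from which induction recovers `c` and the later angles; the first entry then yields `a
0` and `b 0`. If it is zero, the constraints kill every angle but `c`. -/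
theorem antiRow_injective {n : ℕ} {a b a' b' : ℕ → ℝ} {c c' : ℝ} (hab : AntiAngles n a b)
    (hab' : AntiAngles n a' b') (hc : c ∈ Set.Ico 0 (2 * Real.pi))
    (hc' : c' ∈ Set.Ico 0 (2 * Real.pi))
    (h : ∀ j, Complex.exp (Complex.I * c) * antiRow n a b j =
      Complex.exp (Complex.I * c') * antiRow n a' b' j) :
    c = c' ∧ ∀ j < n, a j = a' j ∧ b j = b' j := by
  induction n generalizing a b a' b' with
  | zero =>
    refine ⟨eq_of_exp_I_mul_eq hc hc' ?_, fun j hj => by omega⟩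
    simpa [antiRow] using h 0
  | succ n ih =>
    obtain ⟨h1, h2, h3, h4, h5⟩ := antiAngles_succ.1 hab
    obtain ⟨h1', h2', h3', h4', h5'⟩ := antiAngles_succ.1 hab'
    have hs (j : Fin (n + 1)) := h j.succ
    simp_rw [antiRow_succ_succ] at hs
    have hsin : Real.sin (a 0) = Real.sin (a' 0) := by
      -- Comparing the norms of the tails isolates the sines, since `antiRow` is a unit vector;
      -- sines are nonnegative on `[0, π)`.
      have h6 : ∑ j, ‖Complex.exp (Complex.I * c) * (Complex.I * Real.sin (a 0) *
          antiRow n (fun j => a (j + 1)) (fun j => b (j + 1)) j)‖ ^ 2 =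
          ∑ j, ‖Complex.exp (Complex.I * c') * (Complex.I * Real.sin (a' 0) *
          antiRow n (fun j => a' (j + 1)) (fun j => b' (j + 1)) j)‖ ^ 2 := by simp_rw [hs]
      simp_rw [norm_mul, mul_pow, ← Finset.mul_sum, sum_norm_antiRow, norm_exp_I_mul,
        Complex.norm_real, Complex.norm_I, Real.norm_eq_abs, sq_abs, one_pow, one_mul,
        mul_one] at h6
      exact (pow_left_inj₀ (Real.sin_nonneg_of_mem_Icc ⟨h1.1, h1.2.le⟩)
        (Real.sin_nonneg_of_mem_Icc ⟨h1'.1, h1'.2.le⟩) two_ne_zero).1 h6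
    have h0 := h 0
    rw [antiRow_succ_zero, antiRow_succ_zero] at h0
    by_cases hz : Real.sin (a 0) = 0
    · have ha := eq_zero_of_sin_eq_zero h1 hz
      have ha' := eq_zero_of_sin_eq_zero h1' (hsin ▸ hz)
      have hb := h3 (.inl ha)
      have hb' := h3' (.inl ha')
      rw [ha, ha', hb, hb'] at h0
      refine ⟨eq_of_exp_I_mul_eq hc hc' (by simpa using h0), fun j hj => ?_⟩
      cases j with
      | zero => exact ⟨ha.trans ha'.symm, hb.trans hb'.symm⟩
      | succ j =>
        have e := h4 ha j (by omega)
        have e' := h4' ha' j (by omega)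
        exact ⟨e.trans e'.symm,
          ((h5 j (by omega)).2.2.2 (.inl e)).trans ((h5' j (by omega)).2.2.2 (.inl e')).symm⟩
    · have hz' : Complex.I * Real.sin (a 0) ≠ 0 :=
        mul_ne_zero Complex.I_ne_zero (by exact_mod_cast hz)
      obtain ⟨rfl, h6⟩ := ih h5 h5' fun j => by
        refine mul_left_cancel₀ hz' ?_
        have := hs j
        rw [← hsin] at this
        linear_combination this
      have h7 := eq_and_eq_of_exp_mul_cos_eq h1 h1' h2 h2' (fun h => h3 (.inr h))
        (fun h => h3' (.inr h)) (mul_left_cancel₀ (Complex.exp_ne_zero _) h0)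
      refine ⟨rfl, fun j hj => ?_⟩
      cases j with
      | zero => exact h7
      | succ j => exact h6 j (by omega)

/-- The inverse of the coordinates: the tail, once normalised, determines `c` by induction, and the
first entry with that phase removed determines the first pair of angles. A zero tail must be treated
apart, as it cannot be normalised. -/
theorem exists_antiRow (n : ℕ) (r : Fin (n + 1) → ℂ) (hr : ∑ j, ‖r j‖ ^ 2 = 1) :
    ∃ c ∈ Set.Ico 0 (2 * Real.pi), ∃ a b, AntiAngles n a b ∧
      ∀ j, r j = Complex.exp (Complex.I * c) * antiRow n a b j := by
  induction n with
  | zero =>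
    have hr' : ‖r 0‖ = 1 := by
      have : ‖r 0‖ ^ 2 = 1 := by simpa using hr
      exact (pow_eq_one_iff_of_nonneg (norm_nonneg _) two_ne_zero).1 this
    obtain ⟨c, hc, h⟩ := exists_exp_I_mul_eq hr'
    refine ⟨c, hc, fun _ => 0, fun _ => 0, antiAngles_zero 0, fun j => ?_⟩
    fin_cases j
    simpa [antiRow] using h
  | succ n ih =>
    rw [Fin.sum_univ_succ] at hr
    set t := ∑ j : Fin (n + 1), ‖r j.succ‖ ^ 2 with ht
    have ht0 : 0 ≤ t := Finset.sum_nonneg fun _ _ => by positivity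
    rcases ht0.eq_or_lt with h0 | h0
    · have hr' : ‖r 0‖ = 1 := by
        rw [← h0, add_zero] at hr
        exact (pow_eq_one_iff_of_nonneg (norm_nonneg _) two_ne_zero).1 hr
      obtain ⟨c, hc, h⟩ := exists_exp_I_mul_eq hr'
      refine ⟨c, hc, fun _ => 0, fun _ => 0, antiAngles_zero _, fun j => ?_⟩
      refine Fin.cases ?_ (fun j => ?_) j
      · simpa [antiRow_succ_zero] using h
      · have := (Finset.sum_eq_zero_iff_of_nonneg fun _ _ => by positivity).1 h0.symm j
          (Finset.mem_univ _)
        simpa [antiRow_succ_succ] using this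
    · have hs : (Complex.I * √t : ℂ) ≠ 0 :=
        mul_ne_zero Complex.I_ne_zero (by exact_mod_cast (Real.sqrt_pos.2 h0).ne')
      obtain ⟨c, hc, a, b, hab, h⟩ := ih (fun j => r j.succ / (Complex.I * √t)) (by
        simp_rw [norm_div, div_pow, ← Finset.sum_div]
        rw [← ht, norm_mul, Complex.norm_I, one_mul, Complex.norm_real, Real.norm_eq_abs, sq_abs,
          Real.sq_sqrt ht0, div_self h0.ne'])
      have he : Complex.exp (Complex.I * (-c : ℝ)) * Complex.exp (Complex.I * c) = 1 := by
        rw [← Complex.exp_add, Complex.ofReal_neg, mul_neg, neg_add_cancel, Complex.exp_zero]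
      have hn : ‖Complex.exp (Complex.I * (-c : ℝ)) * r 0‖ = ‖r 0‖ := by
        rw [norm_mul, norm_exp_I_mul, one_mul]
      -- The nonzero tail makes `‖r 0‖ < 1`, and `sin a₀` comes out as `√t`, exactly the factor
      -- divided out of the tail.
      obtain ⟨a₀, ha₀, b₀, hb₀, hab₀, hz, hsin⟩ :=
        exists_exp_mul_cos_eq (z := Complex.exp (Complex.I * (-c : ℝ)) * r 0)
          (by rw [hn]; nlinarith [norm_nonneg (r 0)])
      rw [hn, show 1 - ‖r 0‖ ^ 2 = t by linarith] at hsin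
      refine ⟨c, hc, consSeq a₀ a, consSeq b₀ b, antiAngles_succ.2 ⟨⟨ha₀.1.le, ha₀.2⟩, hb₀,
        fun h => hab₀ (h.resolve_left ha₀.1.ne'), fun h => absurd h ha₀.1.ne', hab⟩, fun j => ?_⟩
      refine Fin.cases ?_ (fun j => ?_) j
      · rw [antiRow_succ_zero]
        change _ = _ * (Complex.exp (Complex.I * b₀) * Real.cos a₀)
        rw [← hz]
        linear_combination (-r 0) * he
      · rw [antiRow_succ_succ]
        change _ = _ * (Complex.I * Real.sin a₀ * antiRow n a b j)
        rw [hsin]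
        have := (div_eq_iff hs).1 (h j)
        linear_combination this

/-! ### Triangles and unitary matrices -/

/-- The factor `shift T` does not affect row `0`, so `antiRow_injective` identifies the first
antidiagonals; unitarity cancels them, and the lower blocks are compared by induction. -/
theorem mat_injective_of_isTriangularNF {n : ℕ} {N N' : PPCircuit n} (hN : IsTriangularNF N)
    (hN' : IsTriangularNF N') (h : mat N = mat N') : N = N' := by
  induction n with
  | zero => rw [(isTriangularNF_zero N).1 hN, (isTriangularNF_zero N').1 hN']
  | succ n ih =>
    obtain ⟨T, a, b, c, hc, hT, hab, rfl⟩ := isTriangularNF_succ.1 hN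
    obtain ⟨T', a', b', c', hc', hT', hab', rfl⟩ := isTriangularNF_succ.1 hN'
    have hrow (T : PPCircuit n) (X : PPCircuit (n + 1)) (j : Fin (n + 1)) :
        mat (shift T * X) 0 j = mat X 0 j := by
      rw [map_mul, Matrix.mul_apply, Fin.sum_univ_succ, mat_shift_zero_zero]
      simp
    rw [mul_assoc, mul_assoc] at h
    obtain ⟨rfl, hj⟩ := antiRow_injective hab hab' hc hc' fun j => by
      rw [← mat_phase_anti_zero, ← mat_phase_anti_zero, ← hrow T, h, hrow]
    rw [← anti_congr hj] at h ⊢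
    rw [map_mul, map_mul mat (shift T')] at h
    have h' := congrArg (· * (mat (top n (sP c) * anti n a b)).conjTranspose) h
    simp only [Matrix.mul_assoc, mat_mul_conjTranspose, Matrix.mul_one] at h'
    rw [ih hT hT' (mat_shift_injective h')]

/-- Elimination of one row: `S` is chosen with the first row of `U`, so `U * S⁻¹` has first row and
first column trivial and its minor is again unitary. -/
theorem exists_isTriangularNF (n : ℕ) (U : Matrix (Fin n) (Fin n) ℂ)
    (hU : U * U.conjTranspose = 1) : ∃ N : PPCircuit n, IsTriangularNF N ∧ mat N = U := by
  induction n with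
  | zero => exact ⟨1, (isTriangularNF_zero 1).2 rfl, Subsingleton.elim _ _⟩
  | succ n ih =>
    obtain ⟨c, hc, a, b, hab, h⟩ := exists_antiRow n (U 0) (by
      have := congrFun (congrFun hU 0) 0
      rw [Matrix.mul_apply, Matrix.one_apply_eq] at this
      have h2 : ∀ j, U 0 j * U.conjTranspose j 0 = ((‖U 0 j‖ ^ 2 : ℝ) : ℂ) := fun j => by
        rw [Matrix.conjTranspose_apply, Complex.star_def, Complex.mul_conj,
          Complex.normSq_eq_norm_sq]
      simp_rw [h2] at this
      exact_mod_cast this)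
    set S := top n (sP c) * anti n a b with hS
    have hSS := mat_mul_conjTranspose S
    have hSS' := mul_eq_one_comm.1 hSS
    set V := U * (mat S).conjTranspose with hV
    have hVV : V * V.conjTranspose = 1 := by
      rw [hV, Matrix.conjTranspose_mul, Matrix.conjTranspose_conjTranspose, Matrix.mul_assoc,
        ← Matrix.mul_assoc _ (mat S), hSS', Matrix.one_mul, hU]
    have hV0 : ∀ j, V 0 j = (1 : Matrix (Fin (n + 1)) (Fin (n + 1)) ℂ) 0 j := fun j => by
      rw [← hSS, hV, Matrix.mul_apply, Matrix.mul_apply]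
      refine Finset.sum_congr rfl fun l _ => ?_
      rw [h l, hS, mat_phase_anti_zero]
    -- Row `0` of `V` is the first basis vector, so orthogonality of the other rows to it says that
    -- their first entries vanish.
    have hV1 : ∀ i : Fin n, V i.succ 0 = 0 := fun i => by
      have := congrFun (congrFun hVV i.succ) 0
      rw [Matrix.mul_apply, Fin.sum_univ_succ] at this
      simpa [hV0, Matrix.one_apply, (Fin.succ_ne_zero _).symm] using this
    obtain ⟨T, hT, hTV⟩ := ih (V.submatrix Fin.succ Fin.succ) (by
      ext i j
      have := congrFun (congrFun hVV i.succ) j.succ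
      rw [Matrix.mul_apply, Fin.sum_univ_succ, hV1, zero_mul, zero_add] at this
      rw [Matrix.mul_apply]
      simpa [Matrix.one_apply] using this)
    refine ⟨shift T * top n (sP c) * anti n a b,
      isTriangularNF_succ.2 ⟨T, a, b, c, hc, hT, hab, rfl⟩, ?_⟩
    have : mat (shift T) = V := by
      ext i j
      refine Fin.cases ?_ (fun i => ?_) i <;> refine Fin.cases ?_ (fun j => ?_) j
      · simp [hV0]
      · simp [hV0, (Fin.succ_ne_zero _).symm]
      · simp [hV1]
      · simp [hTV]
    rw [mul_assoc, map_mul, ← hS, this, hV, Matrix.mul_assoc, hSS', Matrix.mul_one]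

end PPCircuit

/-! ### Irreducible circuits are triangular -/

namespace PPCircuit

theorem top_zero_phase (x : PPCircuit 1) : (top 0 x : PPCircuit 1) = x := by
  induction x using Quotient.ind
  exact Quotient.sound (.trans (top_proEq 0 _) (.tensor_empty _))

theorem top_zero_bs (x : PPCircuit 2) : (top 0 x : PPCircuit 2) = x := by
  induction x using Quotient.ind
  exact Quotient.sound (.trans (top_proEq 0 _) (.tensor_empty _))

theorem mat_top_congr (n : ℕ) {a : ℕ} {x y : PPCircuit a} (h : mat x = mat y) :
    mat (top n x) = mat (top n y) := by
  obtain ⟨x, rfl⟩ := x.exists_term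
  obtain ⟨y, rfl⟩ := y.exists_term
  rw [mat_toCircuit, mat_toCircuit, sem_eq_iff] at h
  rw [top_toCircuit, top_toCircuit, mat_toCircuit, mat_toCircuit, sem_eq_iff,
    (top_proEq n x).semN_eq, (top_proEq n y).semN_eq]
  ext i j
  rw [semN_tensor, semN_tensor, h]

theorem mat_shift_congr {n : ℕ} {x y : PPCircuit n} (h : mat x = mat y) :
    mat (shift x) = mat (shift y) := by
  ext i j
  refine Fin.cases ?_ (fun i => ?_) i <;> refine Fin.cases ?_ (fun j => ?_) j <;> simp [h]

/-! ### The Euler rules as statements about circuits, and their applicability. -/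

theorem triangle2_toCircuit (α₁ β₁ β₂ β₃ : ℝ) : (triangle2 α₁ β₁ β₂ β₃).toCircuit =
    top 1 (P β₂) * shift (P β₃) * (B α₁ * top 1 (P β₁)) := by
  simp only [triangle2, toCircuit_comp, toCircuit_tensor_one_one, toCircuit_wire, map_one, mul_one]
  rfl

theorem triangle3_toCircuit (α₁ α₂ α₃ β₁ β₂ β₃ β₄ β₅ β₆ : ℝ) :
    (triangle3 α₁ α₂ α₃ β₁ β₂ β₃ β₄ β₅ β₆).toCircuit =
      top 2 (P β₄) * shift (top 1 (P β₅)) * shift (shift (P β₆)) *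
        (shift (B α₃ * top 1 (P β₃)) * (top 1 (B α₂ * top 1 (P β₂)) *
          shift (B α₁ * top 1 (P β₁)))) := by
  simp only [triangle3, toCircuit_comp, toCircuit_tensor_tensor, toCircuit_tensor_one_two,
    toCircuit_tensor_two_wire, toCircuit_tensor_one_one, toCircuit_wire, map_one, mul_one, one_mul]
  rfl

theorem twoBS_toCircuit (θ₁ θ₂ : ℝ) (φ : Option ℝ) : (twoBS θ₁ θ₂ φ).toCircuit =
    B θ₂ * (top 1 (optPhase φ).toCircuit * B θ₁) := by
  simp only [twoBS, toCircuit_comp, toCircuit_tensor_one_one, toCircuit_wire, map_one, mul_one]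
  rfl

theorem threeBS_toCircuit (θ₁ θ₂ θ₃ : ℝ) (φ₁ φ₂ : Option ℝ) :
    (threeBS θ₁ θ₂ θ₃ φ₁ φ₂).toCircuit = top 1 (B θ₃) * (shift (B θ₂) *
      (top 2 (optPhase φ₂).toCircuit * shift (top 1 (optPhase φ₁).toCircuit) *
        top 1 (B θ₁))) := by
  simp only [threeBS, toCircuit_comp, toCircuit_tensor_tensor, toCircuit_tensor_one_two,
    toCircuit_tensor_two_wire (bs _), toCircuit_wire, map_one, mul_one, one_mul]
  rfl

theorem anti_one (a b : ℕ → ℝ) : anti 1 a b = sB (a 0) * top 1 (sP (b 0)) := by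
  simp only [anti, map_one, mul_one]
  exact top_zero_bs _

theorem tri_two (α β : ℕ → ℕ → ℝ) (γ : ℕ → ℝ) : tri 2 α β γ =
    top 1 (sP (γ 0)) * shift (sP (γ 1)) * (sB (α 0 0) * top 1 (sP (β 0 0))) := by
  have h : tri 1 (fun i => α (i + 1)) (fun i => β (i + 1)) (fun i => γ (i + 1)) = sP (γ 1) := by
    simp only [tri, anti, map_one, mul_one, one_mul]
    exact top_zero_phase _
  rw [tri, h, anti_one, top_mul_shift]

theorem tri_three (α β : ℕ → ℕ → ℝ) (γ : ℕ → ℝ) : tri 3 α β γ =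
    top 2 (sP (γ 0)) * shift (top 1 (sP (γ 1))) * shift (shift (sP (γ 2))) *
      (shift (sB (α 1 0) * top 1 (sP (β 1 0))) * (top 1 (sB (α 0 0) * top 1 (sP (β 0 0))) *
        shift (sB (α 0 1) * top 1 (sP (β 0 1))))) := by
  rw [tri, ← top_mul_shift, tri_two, anti, anti_one]
  simp only [map_mul, mul_assoc]

/-- Only matrices can be compared: the rule writes generators of angle `0` explicitly, while `tri`
omits them. -/
theorem mat_triangle2 (α β : ℕ → ℕ → ℝ) (γ : ℕ → ℝ) :
    (triangle2 (α 0 0) (β 0 0) (γ 0) (γ 1)).sem = mat (tri 2 α β γ) := by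
  rw [← mat_toCircuit, triangle2_toCircuit, tri_two]
  simp only [map_mul mat, mat_top_congr 1 (mat_sP _), mat_shift_congr (mat_sP _), mat_sB]

theorem mat_triangle3 (α β : ℕ → ℕ → ℝ) (γ : ℕ → ℝ) :
    (triangle3 (α 0 1) (α 0 0) (α 1 0) (β 0 1) (β 0 0) (β 1 0) (γ 0) (γ 1) (γ 2)).sem =
      mat (tri 3 α β γ) := by
  have h (θ φ : ℝ) : mat (sB θ * top 1 (sP φ)) = mat (B θ * top 1 (P φ)) := by
    rw [map_mul, map_mul, mat_sB, mat_top_congr 1 (mat_sP _)]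
  rw [← mat_toCircuit, triangle3_toCircuit, tri_three, map_mul mat, map_mul mat, map_mul mat,
    map_mul mat, map_mul mat, map_mul mat, map_mul mat, map_mul mat, map_mul mat, map_mul mat,
    mat_top_congr 2 (mat_sP _), mat_shift_congr (mat_top_congr 1 (mat_sP _)),
    mat_shift_congr (mat_shift_congr (mat_sP _)), mat_shift_congr (h _ _),
    mat_shift_congr (h _ _), mat_top_congr 1 (h _ _)]

/-- A rule instance needs actual angles for its right-hand side; a triangular form of the unitary of
the left-hand side provides them. -/
theorem reducible_twoBS (θ₁ θ₂ : ℝ) (φ : Option ℝ) : Reducible (twoBS θ₁ θ₂ φ).toCircuit := by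
  obtain ⟨N, hN, h⟩ := exists_isTriangularNF 2 (twoBS θ₁ θ₂ φ).sem (sem_mul_conjTranspose _)
  obtain ⟨α, β, γ, ⟨ha, hγ⟩, rfl⟩ := isTriangularNF_iff.1 hN
  obtain ⟨h1, h2, -, h4⟩ := ha 0 0 (by omega)
  exact .of_rule (.euler2 θ₁ θ₂ φ (α 0 0) (β 0 0) (γ 0) (γ 1)
    ⟨h1, h2, hγ 0 (by omega), hγ 1 (by omega), h4⟩ ((mat_triangle2 α β γ).trans h))

theorem reducible_threeBS (θ₁ θ₂ θ₃ : ℝ) (φ₁ φ₂ : Option ℝ) :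
    Reducible (threeBS θ₁ θ₂ θ₃ φ₁ φ₂).toCircuit := by
  obtain ⟨N, hN, h⟩ := exists_isTriangularNF 3 (threeBS θ₁ θ₂ θ₃ φ₁ φ₂).sem
    (sem_mul_conjTranspose _)
  obtain ⟨α, β, γ, ⟨ha, hγ⟩, rfl⟩ := isTriangularNF_iff.1 hN
  obtain ⟨h1, h2, h3, h4⟩ := ha 0 0 (by omega)
  obtain ⟨h1', h2', -, h4'⟩ := ha 0 1 (by omega)
  obtain ⟨h1'', h2'', -, h4''⟩ := ha 1 0 (by omega)
  exact .of_rule (.euler3 θ₁ θ₂ θ₃ φ₁ φ₂ (α 0 1) (α 0 0) (α 1 0) (β 0 1) (β 0 0) (β 1 0)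
    (γ 0) (γ 1) (γ 2)
    ⟨h1', h1, h1'', h2', h2, h2'', hγ 0 (by omega), hγ 1 (by omega), hγ 2 (by omega), h4', h4,
      h4'', fun h => h3 h 1 (by omega) (by omega)⟩ ((mat_triangle3 α β γ).trans h))

/-- Matches the starred phases of a triangle with the optional phases in the Euler rules, angle `0`
being the plain wire. -/
theorem exists_optPhase (φ : ℝ) : ∃ o, (optPhase o).toCircuit = sP φ := by
  by_cases h : φ = 0
  · exact ⟨none, by rw [h, sP_zero]; exact toCircuit_wire⟩
  · exact ⟨some φ, (sP_of_ne_zero h).symm⟩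

theorem reducible_bs_phase_bs (θ₁ θ₂ φ : ℝ) : Reducible (B θ₂ * (top 1 (sP φ) * B θ₁)) := by
  obtain ⟨o, ho⟩ := exists_optPhase φ
  rw [← ho, ← twoBS_toCircuit]
  exact reducible_twoBS _ _ _

theorem reducible_bs_bs_bs (θ₁ θ₂ θ₃ φ₁ φ₂ : ℝ) : Reducible (top 1 (B θ₃) * (shift (B θ₂) *
    (top 2 (sP φ₂) * shift (top 1 (sP φ₁)) * top 1 (B θ₁))) : PPCircuit 3) := by
  obtain ⟨o₁, ho₁⟩ := exists_optPhase φ₁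
  obtain ⟨o₂, ho₂⟩ := exists_optPhase φ₂
  rw [← ho₁, ← ho₂, ← threeBS_toCircuit]
  exact reducible_threeBS _ _ _ _ _

/-- `R` acts from wire 2 on and slides before the first beam splitter; the phase `φ₂` on wire 0
slides past the beam splitter on wires 1 and 2. What remains on the top three wires is a left-hand
side of `euler3`. -/
theorem reducible_staircase (m : ℕ) (θ₃ φ₂ θ₂ φ₁ θ₁ : ℝ) (R : PPCircuit (m + 1)) :
    Reducible (top (m + 1) (B θ₃ * top 1 (sP φ₂)) *
      (shift (top m (B θ₂ * top 1 (sP φ₁)) * shift R) * top (m + 1) (B θ₁)) :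
        PPCircuit (m + 3)) := by
  have h := (reducible_bs_bs_bs θ₁ θ₂ θ₃ φ₁ φ₂).top m
  have hc := top_mul_shift (sP φ₂) (top m (B θ₂))
  rw [map_mul shift, mul_assoc, ← top_mul_shift_shift, ← mul_assoc, ← mul_assoc]
  refine .mul_right ?_ _
  convert h using 1
  simp only [map_mul, ← shift_top]
  rw [top_top_one_bs, top_top_one_bs, top_top_two_phase, top_top_one_phase (m + 1)]
  simp only [mul_assoc]
  rw [← mul_assoc _ (shift (top m (B θ₂))), hc]
  simp only [mul_assoc]

/-! ### Appending one generator to a triangular normal form. -/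

theorem reducible_P {φ : ℝ} (h : φ ∉ Set.Ioo 0 (2 * Real.pi)) : Reducible (P φ) := by
  by_cases h0 : φ = 0
  · rw [h0]; exact .of_rule .phase_zero
  · exact .of_rule (.phase_mod φ fun h' => h ⟨lt_of_le_of_ne h'.1 (Ne.symm h0), h'.2⟩)

theorem reducible_B {θ : ℝ} (h : θ ∉ Set.Ioo 0 Real.pi) : Reducible (B θ) := by
  by_cases h0 : θ = 0
  · rw [h0]; exact .of_rule .bs_zero
  by_cases h1 : θ ∈ Set.Ico 0 (2 * Real.pi)
  · refine .of_rule (.bs_sub_pi θ ⟨?_, h1.2⟩)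
    by_contra! h2
    exact h ⟨lt_of_le_of_ne h1.1 (Ne.symm h0), h2⟩
  · exact .of_rule (.bs_mod θ h1)

theorem reducible_phase_mul_or {φ c : ℝ} (hc : c ∈ Set.Ico 0 (2 * Real.pi)) :
    Reducible (P φ * sP c) ∨ ∃ c' ∈ Set.Ico 0 (2 * Real.pi), P φ * sP c = sP c' := by
  by_cases h : φ ∈ Set.Ioo 0 (2 * Real.pi)
  · by_cases h0 : c = 0
    · exact .inr ⟨φ, ⟨h.1.le, h.2⟩, by rw [h0, sP_zero, mul_one, sP_of_ne_zero h.1.ne']⟩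
    · rw [sP_of_ne_zero h0]
      exact .inl (.of_rule (.phase_fusion c φ ⟨lt_of_le_of_ne hc.1 (Ne.symm h0), hc.2⟩ h))
  · exact .inl ((reducible_P h).mul_right _)

/-- The rules for single generators and for phases meeting a beam splitter remove everything except
a pair `(θ, c₀)` allowed as the leading angles of an antidiagonal. -/
theorem reducible_bs_mul_or {θ c₀ c₁ : ℝ} (hc₀ : c₀ ∈ Set.Ico 0 (2 * Real.pi))
    (hc₁ : c₁ ∈ Set.Ico 0 (2 * Real.pi)) :
    Reducible (B θ * shift (sP c₁) * top 1 (sP c₀)) ∨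
      (θ ∈ Set.Ioo 0 Real.pi ∧ c₁ = 0 ∧ c₀ ∈ Set.Ico 0 Real.pi ∧
        (θ = Real.pi / 2 → c₀ = 0)) := by
  by_cases hθ : θ ∈ Set.Ioo 0 Real.pi
  swap
  · exact .inl (((reducible_B hθ).mul_right _).mul_right _)
  by_cases h1 : c₁ = 0
  swap
  · refine .inl (.mul_right ?_ _)
    have := Reducible.of_rule
      (.bottom_phase c₁ θ ⟨lt_of_le_of_ne hc₁.1 (Ne.symm h1), hc₁.2⟩ hθ)
    rw [toCircuit_comp, toCircuit_tensor_one_one, toCircuit_wire, map_one, one_mul] at this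
    rwa [sP_of_ne_zero h1]
  rw [h1, sP_zero, map_one, mul_one]
  by_cases h0 : c₀ = 0
  · exact .inr ⟨hθ, rfl, by rw [h0]; exact ⟨le_rfl, Real.pi_pos⟩, fun _ => h0⟩
  by_cases h2 : θ = Real.pi / 2
  · left
    have := Reducible.of_rule
      (.top_phase_half_pi c₀ ⟨lt_of_le_of_ne hc₀.1 (Ne.symm h0), hc₀.2⟩)
    rw [toCircuit_comp, toCircuit_tensor_one_one, toCircuit_wire, map_one, mul_one] at this
    rwa [sP_of_ne_zero h0, h2]
  by_cases h3 : c₀ < Real.pi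
  · exact .inr ⟨hθ, rfl, ⟨hc₀.1, h3⟩, fun h => absurd h h2⟩
  · left
    have := Reducible.of_rule (.top_phase_sub_pi c₀ θ ⟨not_lt.1 h3, hc₀.2⟩ hθ h2)
    rw [toCircuit_comp, toCircuit_tensor_one_one, toCircuit_wire, map_one, mul_one] at this
    rwa [sP_of_ne_zero h0]

theorem reducible_or_isTriangularNF_phase_mul (n : ℕ) (φ : ℝ) {N : PPCircuit (n + 1)}
    (hN : IsTriangularNF N) :
    Reducible (top n (P φ) * N) ∨ IsTriangularNF (top n (P φ) * N) := by
  obtain ⟨T, a, b, c, hc, hT, hab, rfl⟩ := isTriangularNF_succ.1 hN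
  have : top n (P φ) * (shift T * top n (sP c) * anti n a b) =
      shift T * top n (P φ * sP c) * anti n a b := by
    rw [mul_assoc, ← mul_assoc, top_mul_shift, map_mul]
    simp only [mul_assoc]
  rw [this]
  rcases reducible_phase_mul_or hc with h | ⟨c', hc', h⟩
  · exact .inl (((h.top n).mul_left _).mul_right _)
  · rw [h]
    exact .inr (isTriangularNF_succ.2 ⟨T, a, b, c', hc', hT, hab, rfl⟩)

theorem reducible_or_isTriangularNF_bs_mul (n : ℕ) (θ : ℝ) {N : PPCircuit (n + 2)}
    (hN : IsTriangularNF N) :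
    Reducible (top n (B θ) * N) ∨ IsTriangularNF (top n (B θ) * N) := by
  obtain ⟨T', a₀, b₀, c₀, hc₀, hT', hab₀, rfl⟩ := isTriangularNF_succ.1 hN
  obtain ⟨T, a₁, b₁, c₁, hc₁, hT, hab₁, rfl⟩ := isTriangularNF_succ.1 hT'
  -- `T` starts at wire 2, so the beam splitter slides before it; the phase `c₀` on wire 0 commutes
  -- with the second antidiagonal. The new beam splitter then directly follows `c₁` and `c₀`.
  have hE : top n (B θ) * (shift (shift T * top n (sP c₁) * anti n a₁ b₁) *
      top (n + 1) (sP c₀) * anti (n + 1) a₀ b₀) =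
      shift (shift T) * top n (B θ * shift (sP c₁) * top 1 (sP c₀)) *
        (shift (anti n a₁ b₁) * anti (n + 1) a₀ b₀) := by
    calc _ = top n (B θ) * shift (shift T) * shift (top n (sP c₁)) *
          (shift (anti n a₁ b₁) * top (n + 1) (sP c₀)) * anti (n + 1) a₀ b₀ := by
          simp only [map_mul, mul_assoc]
      _ = _ := by
          rw [top_mul_shift_shift, ← top_mul_shift, shift_top, ← top_top_one_phase]
          simp only [map_mul, mul_assoc]
  rw [hE]
  rcases reducible_bs_mul_or (θ := θ) hc₀ hc₁ with h | ⟨hθ, rfl, hc₀', hθc⟩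
  · exact .inl (((h.top n).mul_left _).mul_right _)
  rw [sP_zero, map_one, mul_one]
  by_cases h0 : a₀ 0 = 0
  · right
    rw [hab₀.anti_eq_one (.inr h0), mul_one]
    -- With the first antidiagonal trivial, the beam splitter and `c₀` extend the second one to a
    -- new first antidiagonal. The second becomes empty and both final phases are `0`.
    refine isTriangularNF_succ.2 ⟨_, consSeq θ a₁, consSeq c₀ b₁, 0, ⟨le_rfl, Real.two_pi_pos⟩,
      isTriangularNF_succ.2 ⟨T, _, _, 0, ⟨le_rfl, Real.two_pi_pos⟩, hT, antiAngles_zero n, rfl⟩,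
      antiAngles_succ.2 ⟨⟨hθ.1.le, hθ.2⟩, hc₀', fun h => hθc (h.resolve_left hθ.1.ne'),
        fun h => absurd h hθ.1.ne', hab₁⟩, ?_⟩
    rw [anti_zero, sP_zero, map_one, map_one, mul_one, mul_one, mul_one]
    change _ = _ * (top n (sB θ * top 1 (sP c₀)) * shift (anti n a₁ b₁))
    rw [sB_of_ne_zero hθ.1.ne', mul_assoc]
  left
  rw [mul_assoc]
  refine .mul_left ?_ _
  rw [anti, sB_of_ne_zero h0, map_mul (top n) (B (a₀ 0))]
  -- Whether the second antidiagonal separates the new beam splitter from the last one of the first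
  -- antidiagonal decides between `euler2` and `euler3`.
  by_cases h1 : n = 0 ∨ a₁ 0 = 0
  · rw [hab₁.anti_eq_one h1, map_one, one_mul]
    simp only [← mul_assoc]
    refine .mul_right (.mul_right ?_ _) _
    rw [← map_mul, mul_assoc]
    exact (reducible_bs_phase_bs _ _ _).top n
  · obtain ⟨h1, h2⟩ := not_or.1 h1
    obtain ⟨m, rfl⟩ : ∃ m, n = m + 1 := ⟨n - 1, by omega⟩
    rw [anti, sB_of_ne_zero h2]
    simp only [← mul_assoc]
    refine .mul_right (.mul_right ?_ _) _
    rw [mul_assoc]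
    exact reducible_staircase m θ c₀ (a₁ 0) (b₁ 0) (a₀ 0) _

/-- Generators placed on some wires. -/
inductive IsGenerator : ∀ {n : ℕ}, PPCircuit n → Prop
  | phase (n : ℕ) (φ : ℝ) : IsGenerator (top n (P φ))
  | bs (n : ℕ) (θ : ℝ) : IsGenerator (top n (B θ))
  | shift {n : ℕ} {g : PPCircuit n} : IsGenerator g → IsGenerator (shift g)

theorem IsGenerator.reducible_or_isTriangularNF {n : ℕ} {g : PPCircuit n} (hg : IsGenerator g)
    {N : PPCircuit n} (hN : IsTriangularNF N) :
    Reducible (g * N) ∨ IsTriangularNF (g * N) := by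
  induction hg with
  | phase n φ => exact reducible_or_isTriangularNF_phase_mul n φ hN
  | bs n θ => exact reducible_or_isTriangularNF_bs_mul n θ hN
  | shift hg ih =>
    obtain ⟨T, a, b, c, hc, hT, hab, rfl⟩ := isTriangularNF_succ.1 hN
    rw [← mul_assoc, ← mul_assoc, ← map_mul]
    rcases ih hT with h | h
    · exact .inl ((h.shift.mul_right _).mul_right _)
    · exact .inr (isTriangularNF_succ.2 ⟨_, a, b, c, hc, h, hab, rfl⟩)

/-! ### From single generators to arbitrary terms. -/

theorem isGenerator_of_proEq_phase {φ : ℝ} {N : ℕ} {e : PPTerm N} (k r : ℕ)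
    (h : PROEq e (tensor (tensor (idn k) (phase φ)) (idn r))) : IsGenerator e.toCircuit := by
  induction k generalizing N with
  | zero =>
    obtain rfl : N = r + 1 := by have := h.wires_eq; omega
    rw [toCircuit_eq.2 (.trans h (.trans (.tensor_congr (.empty_tensor _) (.refl _))
      (.symm (top_proEq r _)))), ← top_toCircuit]
    exact .phase r φ
  | succ k ih =>
    obtain rfl : N = k + 1 + r + 1 := by have := h.wires_eq; omega
    rw [toCircuit_eq.2 (.trans h (.trans (.tensor_congr (.trans (.tensor_congr
      (.symm (wire_tensor_idn k)) (.refl _)) (.tensor_assoc _ _ _)) (.refl _))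
      (.trans (.tensor_assoc _ _ _) (.symm (shift_proEq _))))), ← shift_toCircuit]
    exact .shift (ih (.refl _))

theorem isGenerator_of_proEq_bs {θ : ℝ} {N : ℕ} {e : PPTerm N} (k r : ℕ)
    (h : PROEq e (tensor (tensor (idn k) (bs θ)) (idn r))) : IsGenerator e.toCircuit := by
  induction k generalizing N with
  | zero =>
    obtain rfl : N = r + 2 := by have := h.wires_eq; omega
    rw [toCircuit_eq.2 (.trans h (.trans (.tensor_congr (.empty_tensor _) (.refl _))
      (.symm (top_proEq r _)))), ← top_toCircuit]
    exact .bs r θ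
  | succ k ih =>
    obtain rfl : N = k + 2 + r + 1 := by have := h.wires_eq; omega
    rw [toCircuit_eq.2 (.trans h (.trans (.tensor_congr (.trans (.tensor_congr
      (.symm (wire_tensor_idn k)) (.refl _)) (.tensor_assoc _ _ _)) (.refl _))
      (.trans (.tensor_assoc _ _ _) (.symm (shift_proEq _))))), ← shift_toCircuit]
    exact .shift (ih (.refl _))

/-- Structural induction with a triangular circuit `T` accumulated on the input side. If `a ∘ b ∘ T`
is not reducible then neither is `b ∘ T`, which becomes the new accumulator for `a`; a tensor is the
composite of its two halves, each padded with wires. Placing `d` on arbitrary wires of a larger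
circuit makes the padding harmless. -/
theorem isTriangularNF_mul_of_not_reducible {m : ℕ} (d : PPTerm m) {N : ℕ} (k r : ℕ)
    {e : PPTerm N} (h : PROEq e (tensor (tensor (idn k) d) (idn r))) {T : PPCircuit N}
    (hT : IsTriangularNF T) (hirr : ¬ Reducible (e.toCircuit * T)) :
    IsTriangularNF (e.toCircuit * T) := by
  have hid {N : ℕ} {e : PPTerm N} {K : ℕ} (h : PROEq e (idn K)) : e.toCircuit = 1 := by
    obtain rfl := h.wires_eq
    exact toCircuit_eq.2 h
  induction d generalizing N k r T with
  | empty =>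
    rw [hid (.trans h (.trans (.tensor_congr (.tensor_empty _) (.refl _)) (idn_tensor_idn k r))),
      one_mul]
    exact hT
  | wire =>
    rw [hid (.trans h (idn_tensor_idn (k + 1) r)), one_mul]
    exact hT
  | phase φ =>
    exact ((isGenerator_of_proEq_phase k r h).reducible_or_isTriangularNF hT).resolve_left hirr
  | bs θ =>
    exact ((isGenerator_of_proEq_bs k r h).reducible_or_isTriangularNF hT).resolve_left hirr
  | @comp m a b iha ihb =>
    obtain rfl := h.wires_eq
    have h' : e.toCircuit = (tensor (tensor (idn k) a) (idn r)).toCircuit *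
        (tensor (tensor (idn k) b) (idn r)).toCircuit := by
      refine toCircuit_eq.2 (.trans h (.symm (.trans (.interchange _ _ _ _) ?_)))
      exact .tensor_congr (.trans (.interchange _ _ _ _) (.tensor_congr (.id_comp _) (.refl _)))
        (.id_comp _)
    rw [h', mul_assoc] at hirr ⊢
    exact iha k r (.refl _) (ihb k r (.refl _) hT fun hr => hirr (hr.mul_left _)) hirr
  | @tensor p q a b iha ihb =>
    obtain rfl := h.wires_eq
    have ha : PROEq (tensor (tensor (idn k) (tensor a (idn q))) (idn r))
        (tensor (tensor (idn k) a) (idn (q + r))) :=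
      .trans (.tensor_congr (.symm (.tensor_assoc _ _ _)) (.refl _))
        (.trans (.tensor_assoc _ _ _) (.tensor_congr (.refl _) (idn_tensor_idn q r)))
    have hb : PROEq (tensor (tensor (idn k) (tensor (idn p) b)) (idn r))
        (tensor (tensor (idn (k + p)) b) (idn r)) :=
      .tensor_congr (.trans (.symm (.tensor_assoc _ _ _))
        (.tensor_congr (idn_tensor_idn k p) (.refl _))) (.refl _)
    have h' : e.toCircuit = (tensor (tensor (idn k) (tensor a (idn q))) (idn r)).toCircuit *
        (tensor (tensor (idn k) (tensor (idn p) b)) (idn r)).toCircuit := by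
      refine toCircuit_eq.2 (.trans h (.symm (.trans (.interchange _ _ _ _) ?_)))
      exact .tensor_congr (.trans (.interchange _ _ _ _) (.tensor_congr (.id_comp _)
        (comp_tensor_idn_idn_tensor a b))) (.id_comp _)
    rw [h', mul_assoc] at hirr ⊢
    exact iha k (q + r) ha (ihb (k + p) r hb hT fun hr => hirr (hr.mul_left _)) hirr

theorem isTriangularNF_one (n : ℕ) : IsTriangularNF (1 : PPCircuit n) := by
  induction n with
  | zero => exact (isTriangularNF_zero 1).2 rfl
  | succ n ih =>
    refine isTriangularNF_succ.2 ⟨1, _, _, 0, ⟨le_rfl, Real.two_pi_pos⟩, ih, antiAngles_zero n, ?_⟩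
    rw [anti_zero, sP_zero, map_one, map_one, mul_one, mul_one]

theorem isTriangularNF_of_isIrreducible {n : ℕ} {D : PPCircuit n} (h : IsIrreducible D) :
    IsTriangularNF D := by
  obtain ⟨d, rfl⟩ := D.exists_term
  have h' : PROEq d (tensor (tensor (idn 0) d) (idn 0)) :=
    .symm (.trans (.tensor_empty _) (.empty_tensor _))
  have := isTriangularNF_mul_of_not_reducible d 0 0 h' (isTriangularNF_one n)
  rw [mul_one] at this
  exact this fun ⟨D', hD'⟩ => h D' hD'

end PPCircuit

end LOv

end

/-! ### Convergence. -/

theorem mainTheorem2 (n : ℕ) (D : LOv.PPCircuit n) :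
    LOv.StronglyNormalising D ∧
    ∃ N : LOv.PPCircuit n,
      LOv.IsTriangularNF N ∧ LOv.IsIrreducible N ∧ LOv.Rewrites D N ∧
      (∀ D' : LOv.PPCircuit n, LOv.Rewrites D D' → LOv.Rewrites D' N) ∧
      (∀ N' : LOv.PPCircuit n, LOv.Rewrites D N' →
        (LOv.IsTriangularNF N' ∨ LOv.IsIrreducible N') → N' = N) := by
  obtain ⟨N, hDN, hN⟩ := LOv.exists_irreducible D
  have hNt := LOv.PPCircuit.isTriangularNF_of_isIrreducible hN
  refine ⟨LOv.stronglyNormalising D, N, hNt, hN, hDN, fun D' hD' => ?_, fun N' hN' h => ?_⟩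
  -- Any irreducible form of `D'` is triangular and has the matrix of `D`, hence is `N`.
  · obtain ⟨N', hDN', hN'⟩ := LOv.exists_irreducible D'
    rwa [LOv.PPCircuit.mat_injective_of_isTriangularNF hNt
      (LOv.PPCircuit.isTriangularNF_of_isIrreducible hN')
      (hDN.mat_eq.symm.trans (hD'.mat_eq.trans hDN'.mat_eq))]
  · exact LOv.PPCircuit.mat_injective_of_isTriangularNF
      (h.elim id LOv.PPCircuit.isTriangularNF_of_isIrreducible) hNt
      (hN'.mat_eq.symm.trans hDN.mat_eq)
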